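/- All graphs are finite, simple and undirected. A cluster graph is a graph each of whose connected components is a complete graph. A monopolar partition of a graph $G=(V,E)$ is a partition $V=C\uplus I$ (parts may be empty) such that $G[C]$ is a cluster graph and $I$ is an independent set of $G$. For $C',I'\subseteq V$, it is a monopolar extension of $(C',I')$ if $C'\subseteq C$ and $I'\subseteq I$. For a list function $L$ with $\emptyset\neq L(v)\subseteq\{\hat C,\hat I\}$ for all $v\in V$, a monopolar partition of $G$ that respects $L$ is a map $f:V\to\{\hat C,\hat I\}$ with $f(v)\in L(v)$ for all $v\in V$ such that $f^{-1}(\hat I)$ is an independent set of $G$ and $f^{-1}(\hat C)$ induces a cluster graph in $G$. Running times are counted in steps of a random access machine, and $\mathcal{O}^{\star}(g(n))$ means at most $q(n)\,g(n)$ for some polynomial $q$. **Theorem 2.** (1) There is an algorithm that takes as input a graph $G$ on $n$ vertices and two vertex subsets $C',I'\subseteq V(G)$ (an instance of Monopolar Extension), runs in $\mathcal{O}^{\star}(1.3734^{n})$ time, and correctly decides whether $G$ admits a monopolar partition that is an extension of $(C',I')$. If such a monopolar extension exists, then the algorithm also outputs one such monopolar partition of $G$. (2) There is an algorithm that takes as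 input a graph $G$ on $n$ vertices and a list function $L$ with $\emptyset\neq L(v)\subseteq\{\hat C,\hat I\}$ for all $v\in V(G)$ (an instance of List Monopolar Partition), runs in $\mathcal{O}^{\star}(1.3734^{n})$ time, and correctly decides whether $G$ admits a monopolar partition that respects $L$. If $G$ does admit such a monopolar partition, then the algorithm also outputs one. -/

import Mathlib

namespace MonopolarAlg

/-! ## Monopolar partitions -/

/-- A cluster graph: every connected component is a complete graph. -/
def IsClusterGraph {V : Type*} (H : SimpleGraph V) : Prop :=
  ∀ K : H.ConnectedComponent, H.IsClique K.supp

/-- `V = C ⊎ I` is a monopolar partition of `G`: `G[C]` is a cluster graph and `I` is an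
independent set. (Either part may be empty.) -/
def IsMonopolarPartition {V : Type*} (G : SimpleGraph V) (C I : Set V) : Prop :=
  C ∪ I = Set.univ ∧ Disjoint C I ∧ IsClusterGraph (G.induce C) ∧ G.IsIndepSet I

/-- The monopolar partition `(C, I)` is a monopolar extension of the pair `(C₀, I₀)`. -/
def IsMonopolarExtension {V : Type*} (G : SimpleGraph V) (C₀ I₀ C I : Set V) : Prop :=
  IsMonopolarPartition G C I ∧ C₀ ⊆ C ∧ I₀ ⊆ I

/-- The two labels that may occur in the lists. -/
inductive Part where
  | cluster
  | indep

/-- The map `f` is a monopolar partition of `G` that respects the list function `L`. -/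
def RespectsList {V : Type*} (G : SimpleGraph V) (L : V → Set Part) (f : V → Part) : Prop :=
  (∀ v, f v ∈ L v) ∧ G.IsIndepSet (f ⁻¹' {Part.indep}) ∧
    IsClusterGraph (G.induce (f ⁻¹' {Part.cluster}))

/-! ## A random access machine with a step count

Registers and arrays hold natural numbers; both are named by natural numbers, and a program, being
a finite term, mentions only finitely many of them. The only arithmetic is successor and truncated
subtraction, so a run of `t` steps contains no number greater than `t` plus the largest number
present in the input or written in the program: charging one unit for each operation never pays for
arithmetic on long numbers. -/

/-- Memory contents: `reg x` is the value of register `x`, and `mem a i` is the `i`-th cell of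
array `a`. -/
structure State where
  reg : ℕ → ℕ
  mem : ℕ → ℕ → ℕ

/-- The state `s` with register `x` overwritten by `v`. -/
def State.setReg (s : State) (x v : ℕ) : State :=
  { s with reg := Function.update s.reg x v }

/-- The state `s` with the `i`-th cell of array `a` overwritten by `v`. -/
def State.setMem (s : State) (a i v : ℕ) : State :=
  { s with mem := Function.update s.mem a (Function.update (s.mem a) i v) }

/-- Programs. The arguments are register names, except for the number `k` in `const` and the array
name `a` in `load` and `store`. -/
inductive Prog where
  /-- do nothing -/
  | skip
  /-- `x := k` -/
  | const (x k : ℕ)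
  /-- `x := y` -/
  | copy (x y : ℕ)
  /-- `x := x + 1` -/
  | succ (x : ℕ)
  /-- `x := y - z`, truncated at zero -/
  | sub (x y z : ℕ)
  /-- `x := a[i]`, with the content of register `i` as index -/
  | load (x a i : ℕ)
  /-- `a[i] := x`, with the content of register `i` as index -/
  | store (a i x : ℕ)
  /-- first `p`, then `q` -/
  | seq (p q : Prog)
  /-- if `x ≠ 0` then `p` else `q` -/
  | cond (x : ℕ) (p q : Prog)
  /-- while `x ≠ 0` do `p` -/
  | loop (x : ℕ) (p : Prog)

/-- `Exec p s t s'`: started in the state `s`, the program `p` halts in the state `s'` after exactly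
`t` steps. Each elementary operation and each evaluation of a test costs one step. -/
inductive Exec : Prog → State → ℕ → State → Prop where
  | skip (s : State) : Exec Prog.skip s 1 s
  | const (x k : ℕ) (s : State) : Exec (Prog.const x k) s 1 (s.setReg x k)
  | copy (x y : ℕ) (s : State) : Exec (Prog.copy x y) s 1 (s.setReg x (s.reg y))
  | succ (x : ℕ) (s : State) : Exec (Prog.succ x) s 1 (s.setReg x (s.reg x + 1))
  | sub (x y z : ℕ) (s : State) : Exec (Prog.sub x y z) s 1 (s.setReg x (s.reg y - s.reg z))
  | load (x a i : ℕ) (s : State) : Exec (Prog.load x a i) s 1 (s.setReg x (s.mem a (s.reg i)))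
  | store (a i x : ℕ) (s : State) :
      Exec (Prog.store a i x) s 1 (s.setMem a (s.reg i) (s.reg x))
  | seq {p q : Prog} {s s₁ s₂ : State} {t₁ t₂ : ℕ} (hp : Exec p s t₁ s₁) (hq : Exec q s₁ t₂ s₂) :
      Exec (Prog.seq p q) s (t₁ + t₂) s₂
  | cond_true {x : ℕ} {p q : Prog} {s s₁ : State} {t : ℕ} (hx : s.reg x ≠ 0)
      (hp : Exec p s t s₁) : Exec (Prog.cond x p q) s (t + 1) s₁
  | cond_false {x : ℕ} {p q : Prog} {s s₁ : State} {t : ℕ} (hx : s.reg x = 0)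
      (hq : Exec q s t s₁) : Exec (Prog.cond x p q) s (t + 1) s₁
  | loop_stop {x : ℕ} {p : Prog} {s : State} (hx : s.reg x = 0) : Exec (Prog.loop x p) s 1 s
  | loop_step {x : ℕ} {p : Prog} {s s₁ s₂ : State} {t₁ t₂ : ℕ} (hx : s.reg x ≠ 0)
      (hp : Exec p s t₁ s₁) (hl : Exec (Prog.loop x p) s₁ t₂ s₂) :
      Exec (Prog.loop x p) s (t₁ + t₂ + 1) s₂

/-- The machine is deterministic: the number of steps and the final state are determined by the
program and the initial state. -/
theorem Exec.deterministic {p : Prog} {s s₁ s₂ : State} {t₁ t₂ : ℕ}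
    (h₁ : Exec p s t₁ s₁) (h₂ : Exec p s t₂ s₂) : t₁ = t₂ ∧ s₁ = s₂ := by
  induction h₁ generalizing t₂ s₂ with
  | seq _ _ ihp ihq =>
    cases h₂ with
    | seq hp hq =>
      obtain ⟨rfl, rfl⟩ := ihp hp
      obtain ⟨rfl, rfl⟩ := ihq hq
      exact ⟨rfl, rfl⟩
  | cond_true hx _ ih =>
    cases h₂ with
    | cond_true _ hp => obtain ⟨rfl, rfl⟩ := ih hp; exact ⟨rfl, rfl⟩
    | cond_false hx' _ => exact absurd hx' hx
  | cond_false hx _ ih =>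
    cases h₂ with
    | cond_true hx' _ => exact absurd hx hx'
    | cond_false _ hq => obtain ⟨rfl, rfl⟩ := ih hq; exact ⟨rfl, rfl⟩
  | loop_stop hx =>
    cases h₂ with
    | loop_stop _ => exact ⟨rfl, rfl⟩
    | loop_step hx' _ _ => exact absurd hx hx'
  | loop_step hx _ _ ihp ihl =>
    cases h₂ with
    | loop_stop hx' => exact absurd hx' hx
    | loop_step _ hp hl =>
      obtain ⟨rfl, rfl⟩ := ihp hp
      obtain ⟨rfl, rfl⟩ := ihl hl
      exact ⟨rfl, rfl⟩
  | _ => cases h₂; exact ⟨rfl, rfl⟩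

/-! ## Inputs, outputs and running times -/

open Classical in
/-- The truth value of a proposition as a bit. -/
noncomputable def bit (P : Prop) : ℕ := if P then 1 else 0

/-- The initial state for a graph `G` on the vertices `0, …, n - 1` with two vertex sets `A`, `B`.
Register `0` holds `n`, array `0` holds the adjacency matrix row by row, and arrays `1` and `2`
hold the characteristic vectors of `A` and `B`; everything else is zero. -/
noncomputable def inputState {n : ℕ} (G : SimpleGraph (Fin n)) (A B : Set (Fin n)) : State where
  reg x := if x = 0 then n else 0
  mem a k :=
    if a = 0 then bit (∃ i j : Fin n, k = i.val * n + j.val ∧ G.Adj i j)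
    else if a = 1 then bit (∃ v : Fin n, k = v.val ∧ v ∈ A)
    else if a = 2 then bit (∃ v : Fin n, k = v.val ∧ v ∈ B)
    else 0

/-- The state `s` displays the vertex sets `C` and `I`, as characteristic vectors in the arrays
`1` and `2`. -/
def Displays {n : ℕ} (s : State) (C I : Set (Fin n)) : Prop :=
  ∀ v : Fin n, s.mem 1 v.val = bit (v ∈ C) ∧ s.mem 2 v.val = bit (v ∈ I)

/-- On every instance `(G, C₀, I₀)` of Monopolar Extension with `n` vertices the program `p` halts
within `T n` steps; if `(C₀, I₀)` has a monopolar extension then it answers 1 in register `0` and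
displays one, and otherwise it answers 0. -/
def SolvesMonopolarExtension (p : Prog) (T : ℕ → ℕ) : Prop :=
  ∀ (n : ℕ) (G : SimpleGraph (Fin n)) (C₀ I₀ : Set (Fin n)),
    ∃ (t : ℕ) (s : State), Exec p (inputState G C₀ I₀) t s ∧ t ≤ T n ∧
      ((∃ C I : Set (Fin n), IsMonopolarExtension G C₀ I₀ C I) →
        s.reg 0 = 1 ∧ ∃ C I : Set (Fin n), IsMonopolarExtension G C₀ I₀ C I ∧ Displays s C I) ∧
      ((¬ ∃ C I : Set (Fin n), IsMonopolarExtension G C₀ I₀ C I) → s.reg 0 = 0)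

/-- On every instance `(G, L)` of List Monopolar Partition with `n` vertices the program `p` halts
within `T n` steps; if `G` has a monopolar partition that respects `L` then it answers 1 in register
`0` and displays the two parts of one, and otherwise it answers 0. The lists are given by the set of
vertices whose list contains the cluster label and the set of those whose list contains the
independent set label. -/
def SolvesListMonopolarPartition (p : Prog) (T : ℕ → ℕ) : Prop :=
  ∀ (n : ℕ) (G : SimpleGraph (Fin n)) (L : Fin n → Set Part), (∀ v, (L v).Nonempty) →
    ∃ (t : ℕ) (s : State),
      Exec p (inputState G {v | Part.cluster ∈ L v} {v | Part.indep ∈ L v}) t s ∧ t ≤ T n ∧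
      ((∃ f : Fin n → Part, RespectsList G L f) →
        s.reg 0 = 1 ∧ ∃ f : Fin n → Part, RespectsList G L f ∧
          Displays s (f ⁻¹' {Part.cluster}) (f ⁻¹' {Part.indep})) ∧
      ((¬ ∃ f : Fin n → Part, RespectsList G L f) → s.reg 0 = 0)

/-- `T = O*(g)`: the function `T` is at most `g` times a polynomial. -/
def IsOStar (T : ℕ → ℕ) (g : ℕ → ℝ) : Prop :=
  ∃ q : Polynomial ℕ, ∀ n : ℕ, (T n : ℝ) ≤ ((q.eval n : ℕ) : ℝ) * g n

end MonopolarAlg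

/-!
The program is a branching algorithm on pairs `(C, I)` of vertex sets that are to be extended to a
monopolar partition. Vertices outside `C ∪ I` are undecided, and a partition is wanted in which
every edge has an end in the cluster part and no induced path on three vertices lies in it. A
worklist of pairs, initially the input pair alone, is processed by the following rules, of which the
first applicable one is used on the current pair.

* A pair that violates a constraint is discarded.
* A vertex with a neighbour in `I` goes to `C`; a vertex that induces a path on three vertices
  together with two vertices of `C` goes to `I`; a vertex without undecided neighbours goes to `I`.
* If two undecided vertices `a`, `c` induce a path together with a vertex of `C`, then `a` and `c`
  cannot both go to the cluster part; call such a pair exclusive. Branch: `a` to `C` and `c` to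
  `I`, or `a` to `I`. With the vertices forced as a consequence, one branch settles at least two
  vertices and the other at least three (`potential_branchPair`), unless `ac` is an isolated edge
  of the graph of undecided vertices, in which case the rule is not used.
* If an undecided vertex `b` has three undecided neighbours, not all adjacent, branch on `b`.
  Putting `b` into `I` settles at least four vertices. Putting `b` into `C` may settle one only,
  but it creates an exclusive pair of nonadjacent vertices, and the good branching on it, or its
  end by other rules, compensates (`potential_branchVertex`).
* Otherwise put any undecided vertex `v` into `I`. This is safe
  (`extendable_insert_of_exhausted`): in the graph of undecided vertices every centre of an induced
  path on three vertices has degree two and every exclusive pair is an isolated edge, so any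
  maximal independent set that contains `v` will do.
* If there is no undecided vertex, the pair is a monopolar extension.

The weight of a pair is `1.3734` to the number of undecided vertices that are not forced, times
`0.917` if an exclusive pair of nonadjacent such vertices is present. Since
`1.3734⁻² + 1.3734⁻³ ≤ 0.917` and `0.917 * 1.3734⁻¹ + 1.3734⁻⁴ ≤ 1`, no branching increases the
total weight. The potential combines the weight with the number of undecided vertices, so that the
total potential of the worklist decreases by at least one in each round and bounds the number of
rounds by `(5n + 5) * 1.3734 ^ n`.

On the machine, the current pair is held in the arrays of the input and output, and the other pairs
on a stack in two further arrays. The conditions of the rules are first-order formulas about the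
graph and the two sets; a formula is compiled to nested searches over the vertices, which take
polynomial time and leave a witness in a register (`Fml.runs_compile_ex`). Hence each round takes
polynomial time. A list instance is turned into an extension instance by complementing the two input
sets and swapping them.
-/

namespace MonopolarAlg

/-! ### Monopolar partitions as two-sided constraints -/

section Constraints

variable {V : Type*}

/-- `a, b, c` is an induced path on three vertices with centre `b`. -/
def IsPath3 (G : SimpleGraph V) (a b c : V) : Prop :=
  G.Adj a b ∧ G.Adj b c ∧ ¬ G.Adj a c ∧ ¬ a = c

/-- The set `{a, b, c}` induces a path on three vertices, with any of the three as its centre. -/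
def InducesPath3 (G : SimpleGraph V) (a b c : V) : Prop :=
  IsPath3 G a b c ∨ IsPath3 G b c a ∨ IsPath3 G c a b

/-- `S` is the cluster part of a monopolar partition: its complement is independent and `S`
contains no induced path on three vertices. -/
def IsClusterPart (G : SimpleGraph V) (S : Set V) : Prop :=
  (∀ u v, G.Adj u v → u ∈ S ∨ v ∈ S) ∧
    ∀ a b c, a ∈ S → b ∈ S → c ∈ S → ¬ IsPath3 G a b c

/-- The pair `(C, I)` extends to a monopolar partition. -/
def Extendable (G : SimpleGraph V) (C I : Set V) : Prop :=
  ∃ S, IsClusterPart G S ∧ C ⊆ S ∧ ∀ v ∈ I, v ∉ S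

/-- An induced subgraph is a cluster graph if and only if it has no induced path on three
vertices. -/
theorem isClusterGraph_induce_iff (G : SimpleGraph V) (S : Set V) :
    IsClusterGraph (G.induce S) ↔ ∀ a b c, a ∈ S → b ∈ S → c ∈ S → ¬ IsPath3 G a b c := by
  constructor
  · rintro h a b c ha hb hc ⟨hab, hbc, hac, hne⟩
    have hab' : (G.induce S).Adj ⟨a, ha⟩ ⟨b, hb⟩ := hab
    have hbc' : (G.induce S).Adj ⟨b, hb⟩ ⟨c, hc⟩ := hbc
    have := h ((G.induce S).connectedComponentMk ⟨a, ha⟩) (x := ⟨a, ha⟩) rfl (y := ⟨c, hc⟩)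
      (by
        rw [SimpleGraph.ConnectedComponent.mem_supp_iff, SimpleGraph.ConnectedComponent.eq]
        exact (hab'.reachable.trans hbc'.reachable).symm)
      (by simpa using hne)
    exact hac this
  · intro h K x hx y hy hxy
    rw [SimpleGraph.ConnectedComponent.mem_supp_iff] at hx hy
    have hr : (G.induce S).Reachable x y := SimpleGraph.ConnectedComponent.exact (hx.trans hy.symm)
    obtain ⟨p⟩ := hr
    clear hx hy
    induction p with
    | nil => exact absurd rfl hxy
    | @cons u v w huv p ih =>
      by_cases hvw : v = w
      · exact hvw ▸ huv
      · by_contra hn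
        exact h u v w u.2 v.2 w.2 ⟨huv, ih hvw, hn, fun e => hxy (Subtype.ext e)⟩

theorem isMonopolarPartition_iff (G : SimpleGraph V) (C I : Set V) :
    IsMonopolarPartition G C I ↔ I = Cᶜ ∧ IsClusterPart G C := by
  unfold IsMonopolarPartition IsClusterPart
  rw [isClusterGraph_induce_iff]
  constructor
  · rintro ⟨hu, hd, hC, hI⟩
    have hIC : I = Cᶜ := (IsCompl.of_eq hd.eq_bot hu).compl_eq.symm
    refine ⟨hIC, fun u v huv => ?_, hC⟩
    by_contra! hn
    subst hIC
    exact hI hn.1 hn.2 huv.ne huv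
  · rintro ⟨rfl, he, hC⟩
    refine ⟨Set.union_compl_self C, disjoint_compl_right, hC, fun u hu v hv _ huv => ?_⟩
    exact (he u v huv).elim hu hv

theorem exists_isMonopolarExtension_iff (G : SimpleGraph V) (C₀ I₀ : Set V) :
    (∃ C I, IsMonopolarExtension G C₀ I₀ C I) ↔ Extendable G C₀ I₀ := by
  constructor
  · rintro ⟨C, I, hp, hC, hI⟩
    obtain ⟨rfl, hS⟩ := (isMonopolarPartition_iff G C I).1 hp
    exact ⟨C, hS, hC, hI⟩
  · rintro ⟨S, hS, hC, hI⟩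
    exact ⟨S, Sᶜ, (isMonopolarPartition_iff G S _).2 ⟨rfl, hS⟩, hC, hI⟩

theorem InducesPath3.ne {G : SimpleGraph V} {a b c : V} (h : InducesPath3 G a b c) : a ≠ b := by
  rintro rfl
  unfold InducesPath3 IsPath3 at h
  have := G.irrefl (v := a)
  simp only [G.adj_comm c] at h
  tauto

theorem IsClusterPart.not_inducesPath3 {G : SimpleGraph V} {S : Set V} (hS : IsClusterPart G S)
    {a b c : V} (ha : a ∈ S) (hb : b ∈ S) (hc : c ∈ S) : ¬ InducesPath3 G a b c := by
  rintro (h | h | h)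
  · exact hS.2 _ _ _ ha hb hc h
  · exact hS.2 _ _ _ hb hc ha h
  · exact hS.2 _ _ _ hc ha hb h

/-- The pair `(C, I)` already violates a constraint. -/
def Conflict (G : SimpleGraph V) (C I : Set V) : Prop :=
  (∃ v, v ∈ C ∧ v ∈ I) ∨ (∃ u v, u ∈ I ∧ v ∈ I ∧ G.Adj u v) ∨
    ∃ a b c, a ∈ C ∧ b ∈ C ∧ c ∈ C ∧ IsPath3 G a b c

/-- The vertex `v` has not been assigned to either part. -/
def Undecided (C I : Set V) (v : V) : Prop := v ∉ C ∧ v ∉ I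

/-- The undecided vertex `v` has to go to the cluster part, because of a neighbour in `I`. -/
def ForcedCluster (G : SimpleGraph V) (C I : Set V) (v : V) : Prop :=
  Undecided C I v ∧ ∃ u, u ∈ I ∧ G.Adj u v

/-- The undecided vertex `v` has to go to the independent part, because it induces a path on three
vertices together with two vertices of `C`. -/
def ForcedIndep (G : SimpleGraph V) (C I : Set V) (v : V) : Prop :=
  Undecided C I v ∧ ∃ p q, p ∈ C ∧ q ∈ C ∧ InducesPath3 G v p q

/-- The undecided vertex `v` has no undecided neighbour. -/
def Isolated (G : SimpleGraph V) (C I : Set V) (v : V) : Prop :=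
  Undecided C I v ∧ ¬ ∃ u, Undecided C I u ∧ G.Adj v u

/-- At most one of the undecided vertices `a`, `c` can go to the cluster part, as the two induce a
path on three vertices together with some vertex of `C`. -/
def Exclusive (G : SimpleGraph V) (C I : Set V) (a c : V) : Prop :=
  Undecided C I a ∧ Undecided C I c ∧ ∃ p, p ∈ C ∧ InducesPath3 G a c p

/-- An exclusive pair on which branching pays off. The exclusive pairs left out are edges `ac`
such that `c` is the only undecided neighbour of `a`. -/
def BranchPair (G : SimpleGraph V) (C I : Set V) (a c : V) : Prop :=
  Exclusive G C I a c ∧ (¬ G.Adj a c ∨ ∃ w, Undecided C I w ∧ ¬ w = c ∧ G.Adj a w)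

/-- The undecided vertex `b` has three undecided neighbours, two of which are not adjacent. -/
def BranchVertex (G : SimpleGraph V) (C I : Set V) (b : V) : Prop :=
  Undecided C I b ∧ ∃ a c d, Undecided C I a ∧ Undecided C I c ∧ Undecided C I d ∧
    G.Adj b a ∧ G.Adj b c ∧ G.Adj b d ∧ ¬ G.Adj a c ∧ ¬ a = c ∧ ¬ a = d ∧ ¬ c = d

variable {G : SimpleGraph V} {C I : Set V}

theorem Conflict.not_extendable (h : Conflict G C I) : ¬ Extendable G C I := by
  rintro ⟨S, hS, hC, hI⟩
  obtain ⟨v, hv, hv'⟩ | ⟨u, v, hu, hv, huv⟩ | ⟨a, b, c, ha, hb, hc, h⟩ := h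
  · exact hI v hv' (hC hv)
  · exact (hS.1 u v huv).elim (hI u hu) (hI v hv)
  · exact hS.2 a b c (hC ha) (hC hb) (hC hc) h

theorem ForcedCluster.extendable {v : V} (hv : ForcedCluster G C I v) (h : Extendable G C I) :
    Extendable G (insert v C) I := by
  obtain ⟨S, hS, hC, hI⟩ := h
  obtain ⟨-, u, hu, huv⟩ := hv
  exact ⟨S, hS, Set.insert_subset ((hS.1 u v huv).resolve_left (hI u hu)) hC, hI⟩

theorem ForcedIndep.extendable {v : V} (hv : ForcedIndep G C I v) (h : Extendable G C I) :
    Extendable G C (insert v I) := by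
  obtain ⟨S, hS, hC, hI⟩ := h
  obtain ⟨-, p, q, hp, hq, h3⟩ := hv
  refine ⟨S, hS, hC, Set.forall_mem_insert.2 ⟨fun hvS => ?_, hI⟩⟩
  exact hS.not_inducesPath3 hvS (hC hp) (hC hq) h3

/-- Moving `v` to the independent part does no harm: all its neighbours lie in `C`. -/
theorem Isolated.extendable {v : V} (hv : Isolated G C I v)
    (hF : ∀ v, ¬ ForcedCluster G C I v) (h : Extendable G C I) :
    Extendable G C (insert v I) := by
  obtain ⟨S, hS, hC, hI⟩ := h
  have hnb : ∀ u, G.Adj v u → u ∈ C := by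
    intro u hu
    by_contra huC
    by_cases huI : u ∈ I
    · exact hF v ⟨hv.1, u, huI, hu.symm⟩
    · exact hv.2 ⟨u, ⟨huC, huI⟩, hu⟩
  refine ⟨S \ {v}, ⟨fun a b hab => ?_, fun a b c ha hb hc => hS.2 a b c ha.1 hb.1 hc.1⟩,
    fun u hu => ⟨hC hu, fun e => hv.1.1 (e ▸ hu)⟩,
    Set.forall_mem_insert.2 ⟨fun h => h.2 rfl, fun u hu h => hI u hu h.1⟩⟩
  by_cases ha : a = v
  · subst ha
    exact Or.inr ⟨hC (hnb b hab), hab.ne'⟩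
  by_cases hb : b = v
  · subst hb
    exact Or.inl ⟨hC (hnb a hab.symm), hab.ne⟩
  exact (hS.1 a b hab).imp (fun h => ⟨h, ha⟩) (fun h => ⟨h, hb⟩)

theorem Exclusive.extendable {a c : V} (hac : Exclusive G C I a c) (h : Extendable G C I) :
    Extendable G (insert a C) (insert c I) ∨ Extendable G C (insert a I) := by
  obtain ⟨S, hS, hC, hI⟩ := h
  obtain ⟨-, -, p, hp, h3⟩ := hac
  by_cases ha : a ∈ S
  · refine Or.inl ⟨S, hS, Set.insert_subset ha hC, Set.forall_mem_insert.2 ⟨fun hc => ?_, hI⟩⟩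
    exact hS.not_inducesPath3 ha hc (hC hp) h3
  · exact Or.inr ⟨S, hS, hC, Set.forall_mem_insert.2 ⟨ha, hI⟩⟩

theorem Extendable.insert_or_insert (h : Extendable G C I) (b : V) :
    Extendable G (insert b C) I ∨ Extendable G C (insert b I) := by
  obtain ⟨S, hS, hC, hI⟩ := h
  by_cases hb : b ∈ S
  · exact Or.inl ⟨S, hS, Set.insert_subset hb hC, hI⟩
  · exact Or.inr ⟨S, hS, hC, Set.forall_mem_insert.2 ⟨hb, hI⟩⟩

/-- Once no other rule applies, the pair is extendable with any undecided vertex `v` in the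
independent part: add to `I` a maximal independent set of undecided vertices that contains `v`. An
induced path among the other undecided vertices would have a centre with no further undecided
neighbour, which could be added to the independent set; an exclusive pair is an isolated edge of
the graph of undecided vertices, so the set meets it. -/
theorem extendable_insert_of_exhausted [Finite V] (hc : ¬ Conflict G C I)
    (hFC : ∀ v, ¬ ForcedCluster G C I v) (hFI : ∀ v, ¬ ForcedIndep G C I v)
    (hP : ∀ a c, ¬ BranchPair G C I a c) (hB : ∀ b, ¬ BranchVertex G C I b)
    {v : V} (hv : Undecided C I v) : Extendable G C (insert v I) := by
  obtain ⟨J, hvJ, hJ⟩ := (Set.toFinite {J : Set V |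
      (∀ u ∈ J, Undecided C I u) ∧ G.IsIndepSet J}).exists_le_maximal (a := {v})
    ⟨by simpa using hv, by simp [SimpleGraph.IsIndepSet]⟩
  rw [Set.singleton_subset_iff] at hvJ
  obtain ⟨⟨hJU, hJI⟩, hJmax⟩ := hJ
  have hJmax : ∀ u, Undecided C I u → u ∉ J → ∃ w ∈ J, G.Adj u w := by
    intro u hu huJ
    by_contra! hn
    refine huJ (hJmax (y := insert u J) ⟨Set.forall_mem_insert.2 ⟨hu, hJU⟩, ?_⟩
      (Set.subset_insert u J) (Set.mem_insert u J))
    exact hJI.insert fun w hw _ => ⟨hn w hw, fun h => hn w hw h.symm⟩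
  have hexcl : ∀ a c, Exclusive G C I a c → a ∉ J → c ∈ J := by
    intro a c hac haJ
    obtain ⟨w, hw, haw⟩ := hJmax a hac.1 haJ
    by_contra hcJ
    exact hP a c ⟨hac, Or.inr ⟨w, hJU w hw, fun e => hcJ (e ▸ hw), haw⟩⟩
  have hmem : ∀ u, u ∈ (I ∪ J)ᶜ → u ∈ C ∨ (Undecided C I u ∧ u ∉ J) := by
    intro u hu
    simp only [Set.mem_compl_iff, Set.mem_union, not_or] at hu
    by_cases h : u ∈ C
    · exact Or.inl h
    · exact Or.inr ⟨⟨h, hu.1⟩, hu.2⟩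
  refine ⟨(I ∪ J)ᶜ, ⟨fun a b hab => ?_, fun a b c ha hb hc' h3 => ?_⟩, fun u hu => ?_,
    Set.forall_mem_insert.2 ⟨by simp [hvJ], fun u hu => by simp [hu]⟩⟩
  · by_contra! hn
    simp only [Set.mem_compl_iff, Set.mem_union, not_not] at hn
    obtain ⟨ha | ha, hb | hb⟩ := hn
    · exact hc (Or.inr (Or.inl ⟨a, b, ha, hb, hab⟩))
    · exact hFC b ⟨hJU b hb, a, ha, hab⟩
    · exact hFC a ⟨hJU a ha, b, hb, hab.symm⟩
    · exact hJI ha hb hab.ne hab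
  · have i1 : InducesPath3 G a b c := Or.inl h3
    have i2 : InducesPath3 G b c a := Or.inr (Or.inr h3)
    have i3 : InducesPath3 G c a b := Or.inr (Or.inl h3)
    obtain ha | ha := hmem a ha <;> obtain hb | hb := hmem b hb <;> obtain hc' | hc' := hmem c hc'
    · exact hc (Or.inr (Or.inr ⟨a, b, c, ha, hb, hc', h3⟩))
    · exact hFI c ⟨hc'.1, a, b, ha, hb, i3⟩
    · exact hFI b ⟨hb.1, c, a, hc', ha, i2⟩
    · exact hc'.2 (hexcl b c ⟨hb.1, hc'.1, a, ha, i2⟩ hb.2)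
    · exact hFI a ⟨ha.1, b, c, hb, hc', i1⟩
    · exact ha.2 (hexcl c a ⟨hc'.1, ha.1, b, hb, i3⟩ hc'.2)
    · exact hb.2 (hexcl a b ⟨ha.1, hb.1, c, hc', i1⟩ ha.2)
    · obtain ⟨w, hw, hbw⟩ := hJmax b hb.1 hb.2
      exact hB b ⟨hb.1, a, c, w, ha.1, hc'.1, hJU w hw, h3.1.symm, h3.2.1, hbw, h3.2.2.1,
        h3.2.2.2, fun e => ha.2 (e ▸ hw), fun e => hc'.2 (e ▸ hw)⟩
  · simp only [Set.mem_compl_iff, Set.mem_union, not_or]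
    exact ⟨fun h => hc (Or.inl ⟨u, hu, h⟩), fun h => (hJU u h).1 hu⟩

theorem isMonopolarExtension_of_decided {C₀ I₀ : Set V} (hc : ¬ Conflict G C I)
    (hU : ∀ v, ¬ Undecided C I v) (hC : C₀ ⊆ C) (hI : I₀ ⊆ I) :
    IsMonopolarExtension G C₀ I₀ C I := by
  have hcompl : I = Cᶜ := by
    ext v
    have h1 : v ∈ C → v ∉ I := fun h h' => hc (Or.inl ⟨v, h, h'⟩)
    have h2 := hU v
    unfold Undecided at h2
    simp only [Set.mem_compl_iff]
    tauto
  refine ⟨(isMonopolarPartition_iff G C I).2 ⟨hcompl, fun u v huv => ?_,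
    fun a b c ha hb hc' h => ?_⟩, hC, hI⟩
  · by_contra! hn
    subst hcompl
    exact hc (Or.inr (Or.inl ⟨u, v, hn.1, hn.2, huv⟩))
  · exact hc (Or.inr (Or.inr ⟨a, b, c, ha, hb, hc', h⟩))

end Constraints

/-! ### The measure of the branching algorithm -/

section Measure

variable {V : Type*}

/-- The undecided vertices that are not forced. -/
def freeSet (G : SimpleGraph V) (C I : Set V) : Set V :=
  {v | Undecided C I v ∧ ¬ ForcedCluster G C I v ∧ ¬ ForcedIndep G C I v}

/-- There is an exclusive pair of nonadjacent free vertices. Such a pair guarantees that the next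
rule that applies is a good one. -/
def HasFreePair (G : SimpleGraph V) (C I : Set V) : Prop :=
  ∃ a c p, a ∈ freeSet G C I ∧ c ∈ freeSet G C I ∧ p ∈ C ∧ IsPath3 G a p c

/-- The base of the exponential running time. -/
noncomputable def base : ℝ := 1.3734

open Classical in
/-- The measure of a pair: exponential in the number of free vertices, with a discount if there is
an exclusive pair of nonadjacent free vertices. The discount `0.917` lies just above
`base⁻² + base⁻³`, the cost of branching on an exclusive pair, and it is what makes branching on a
vertex with only three undecided neighbours affordable. -/
noncomputable def weight (G : SimpleGraph V) (C I : Set V) : ℝ :=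
  (if HasFreePair G C I then 0.917 else 1) * base ^ (freeSet G C I).ncard

/-- A bound for the number of rounds that the algorithm spends on the pair `(C, I)`. The number of
undecided vertices pays for the rounds without branching. -/
noncomputable def potential [Fintype V] (G : SimpleGraph V) (C I : Set V) : ℝ :=
  ({v | Undecided C I v}.ncard : ℝ) + 1 + (2 * Fintype.card V + 2) * (2 * weight G C I - 1)

variable {G : SimpleGraph V} {C I C' I' : Set V}

theorem one_le_base_pow (k : ℕ) : 1 ≤ base ^ k := one_le_pow₀ (by norm_num [base])

theorem weight_le (G : SimpleGraph V) (C I : Set V) :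
    weight G C I ≤ base ^ (freeSet G C I).ncard := by
  have := one_le_base_pow (freeSet G C I).ncard
  unfold weight
  split_ifs <;> linarith

theorem le_weight (G : SimpleGraph V) (C I : Set V) :
    0.917 * base ^ (freeSet G C I).ncard ≤ weight G C I := by
  have := one_le_base_pow (freeSet G C I).ncard
  unfold weight
  split_ifs <;> linarith

theorem one_le_potential [Fintype V] (G : SimpleGraph V) (C I : Set V) : 1 ≤ potential G C I := by
  have h1 := le_weight G C I
  have h2 := one_le_base_pow (freeSet G C I).ncard
  have h3 : (0 : ℝ) ≤ 2 * weight G C I - 1 := by linarith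
  unfold potential
  have : (0 : ℝ) ≤ (2 * Fintype.card V + 2) * (2 * weight G C I - 1) := by positivity
  have : (0 : ℝ) ≤ ({v | Undecided C I v}.ncard : ℝ) := by positivity
  linarith

theorem potential_le [Fintype V] (G : SimpleGraph V) (C I : Set V) :
    potential G C I ≤ (5 * Fintype.card V + 5) * base ^ Fintype.card V := by
  have h1 : base ^ (freeSet G C I).ncard ≤ base ^ Fintype.card V :=
    pow_le_pow_right₀ (by norm_num [base]) (Nat.card_eq_fintype_card (α := V) ▸ Set.ncard_le_card _)
  have h2 := weight_le G C I
  have h3 : ({v | Undecided C I v}.ncard : ℝ) ≤ Fintype.card V := by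
    exact_mod_cast Nat.card_eq_fintype_card (α := V) ▸ Set.ncard_le_card _
  have h4 := one_le_base_pow (Fintype.card V)
  unfold potential
  have hn : (0 : ℝ) ≤ Fintype.card V := by positivity
  nlinarith [mul_le_mul_of_nonneg_left (h2.trans h1) hn, mul_le_mul_of_nonneg_left h4 hn]

theorem not_mem_freeSet_of_mem_left {v : V} (h : v ∈ C) : v ∉ freeSet G C I :=
  fun h' => h'.1.1 h

theorem not_mem_freeSet_of_mem_right {v : V} (h : v ∈ I) : v ∉ freeSet G C I :=
  fun h' => h'.1.2 h

theorem not_mem_freeSet_of_adj {u v : V} (hu : u ∈ I) (h : G.Adj u v) : v ∉ freeSet G C I :=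
  fun h' => h'.2.1 ⟨h'.1, u, hu, h⟩

theorem freeSet_anti (hC : C ⊆ C') (hI : I ⊆ I') : freeSet G C' I' ⊆ freeSet G C I := by
  rintro v ⟨⟨h1, h2⟩, h3, h4⟩
  have hU : Undecided C I v := ⟨fun h => h1 (hC h), fun h => h2 (hI h)⟩
  refine ⟨hU, ?_, ?_⟩
  · rintro ⟨-, u, hu, huv⟩
    exact h3 ⟨⟨h1, h2⟩, u, hI hu, huv⟩
  · rintro ⟨-, p, q, hp, hq, h⟩
    exact h4 ⟨⟨h1, h2⟩, p, q, hC hp, hC hq, h⟩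

/-- Assigning more vertices never increases the weight. If no free vertex is lost, then a free
exclusive pair stays one; if one is lost, then a factor `base` makes up for the discount. -/
theorem weight_anti [Fintype V] (hC : C ⊆ C') (hI : I ⊆ I') : weight G C' I' ≤ weight G C I := by
  have hsub := freeSet_anti (G := G) hC hI
  obtain heq | hlt := eq_or_ne (freeSet G C' I') (freeSet G C I)
  · have hD : HasFreePair G C I → HasFreePair G C' I' := by
      rintro ⟨a, c, p, ha, hc, hp, h⟩
      exact ⟨a, c, p, heq ▸ ha, heq ▸ hc, hC hp, h⟩
    have := one_le_base_pow (freeSet G C I).ncard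
    unfold weight
    rw [heq]
    split_ifs <;> first | linarith | tauto
  · have hcard := Set.ncard_lt_ncard (hsub.ssubset_of_ne hlt)
    have h1 := weight_le G C' I'
    have h2 : base ^ ((freeSet G C' I').ncard + 1) ≤ base ^ (freeSet G C I).ncard :=
      pow_le_pow_right₀ (by norm_num [base]) hcard
    have h3 := le_weight G C I
    have h4 := one_le_base_pow (freeSet G C' I').ncard
    rw [pow_succ] at h2
    unfold base at *
    linarith

/-- If the vertices of `D` stop being free, then the exponent drops by at least `|D|`. -/
theorem base_pow_ncard_mul_le [Fintype V] (hC : C ⊆ C') (hI : I ⊆ I') (D : Finset V)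
    (hD : ∀ v ∈ D, v ∈ freeSet G C I) (hD' : ∀ v ∈ D, v ∉ freeSet G C' I') :
    base ^ (freeSet G C' I').ncard * base ^ D.card ≤ base ^ (freeSet G C I).ncard := by
  rw [← pow_add, ← Set.ncard_coe_finset D, ← Set.ncard_union_eq]
  · exact pow_le_pow_right₀ (by norm_num [base]) (Set.ncard_le_ncard
      (Set.union_subset (freeSet_anti hC hI) hD))
  · exact Set.disjoint_right.2 hD'

theorem weight_mul_le [Fintype V] (hC : C ⊆ C') (hI : I ⊆ I') (D : Finset V)
    (hD : ∀ v ∈ D, v ∈ freeSet G C I) (hD' : ∀ v ∈ D, v ∉ freeSet G C' I') :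
    weight G C' I' * base ^ D.card ≤ base ^ (freeSet G C I).ncard :=
  (mul_le_mul_of_nonneg_right (weight_le G C' I') (zero_le_one.trans (one_le_base_pow _))).trans
    (base_pow_ncard_mul_le hC hI D hD hD')

theorem potential_add_one_le [Fintype V] {v : V} (hC : C ⊆ C') (hI : I ⊆ I') (hv : Undecided C I v)
    (hv' : ¬ Undecided C' I' v) : potential G C' I' + 1 ≤ potential G C I := by
  have h1 : {v | Undecided C' I' v}.ncard + 1 ≤ {v | Undecided C I v}.ncard := by
    refine Set.ncard_lt_ncard (Set.ssubset_iff_exists.2 ⟨?_, v, hv, hv'⟩)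
    exact fun u hu => ⟨fun h => hu.1 (hC h), fun h => hu.2 (hI h)⟩
  have h2 : ({v | Undecided C' I' v}.ncard : ℝ) + 1 ≤ {v | Undecided C I v}.ncard := by
    exact_mod_cast h1
  have h3 := weight_anti (G := G) hC hI
  unfold potential
  have : (2 * Fintype.card V + 2 : ℝ) * (2 * weight G C' I' - 1) ≤
      (2 * Fintype.card V + 2) * (2 * weight G C I - 1) := by gcongr
  linarith

/-- A branching that does not increase the weight decreases the potential: the constant
`-(2n + 2)` in the potential occurs once more for the two branches than for the pair itself, which
makes up for their undecided vertices. -/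
theorem potential_add_potential_le [Fintype V] {C₁ I₁ C₂ I₂ : Set V}
    (h : weight G C₁ I₁ + weight G C₂ I₂ ≤ weight G C I) :
    potential G C₁ I₁ + potential G C₂ I₂ + 1 ≤ potential G C I := by
  have hU : ∀ C I : Set V, ({v | Undecided C I v}.ncard : ℝ) ≤ Fintype.card V := fun C I => by
    exact_mod_cast Nat.card_eq_fintype_card (α := V) ▸ Set.ncard_le_card _
  have h1 := hU C₁ I₁
  have h2 := hU C₂ I₂
  have h3 : (0 : ℝ) ≤ ({v | Undecided C I v}.ncard : ℝ) := by positivity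
  have h4 : (2 * Fintype.card V + 2 : ℝ) * (weight G C₁ I₁ + weight G C₂ I₂) ≤
      (2 * Fintype.card V + 2) * weight G C I := by gcongr
  unfold potential
  linarith

theorem Undecided.mem_freeSet (hFC : ∀ v, ¬ ForcedCluster G C I v)
    (hFI : ∀ v, ¬ ForcedIndep G C I v) {v : V} (hv : Undecided C I v) : v ∈ freeSet G C I :=
  ⟨hv, hFC v, hFI v⟩

/-- Branching on an exclusive pair `a`, `c`. Every undecided vertex has an undecided neighbour. If
`a` and `c` are not adjacent, then putting `a` into `C` and `c` into `I` also settles a neighbour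
of `c`, and putting `a` into `I` settles a neighbour of `a`. If they are adjacent, then putting `a`
into `I` settles two neighbours of `a`. So the two branches lose at least two and three free
vertices, in one order or the other. -/
theorem potential_branchPair [Fintype V] [DecidableEq V] (hFC : ∀ v, ¬ ForcedCluster G C I v)
    (hFI : ∀ v, ¬ ForcedIndep G C I v) (hZ : ∀ v, ¬ Isolated G C I v) {a c : V}
    (h : BranchPair G C I a c) :
    potential G (insert a C) (insert c I) + potential G C (insert a I) + 1 ≤ potential G C I := by
  obtain ⟨⟨ha, hc, p, hp, h3⟩, h⟩ := h
  have hne := h3.ne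
  have free : ∀ {v}, Undecided C I v → v ∈ freeSet G C I := fun hv => hv.mem_freeSet hFC hFI
  apply potential_add_potential_le
  have hk := one_le_base_pow (freeSet G C I).ncard
  have hle := le_weight G C I
  have key : ∀ D₁ D₂ : Finset V, (D₁.card = 3 ∧ D₂.card = 2 ∨ D₁.card = 2 ∧ D₂.card = 3) →
      (∀ v ∈ D₁, v ∈ freeSet G C I ∧ v ∉ freeSet G (insert a C) (insert c I)) →
      (∀ v ∈ D₂, v ∈ freeSet G C I ∧ v ∉ freeSet G C (insert a I)) →
      weight G (insert a C) (insert c I) + weight G C (insert a I) ≤ weight G C I := by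
    intro D₁ D₂ hcard h₁ h₂
    have h1 := weight_mul_le (Set.subset_insert a C) (Set.subset_insert c I) D₁
      (fun v hv => (h₁ v hv).1) (fun v hv => (h₁ v hv).2)
    have h2 := weight_mul_le (subset_refl C) (Set.subset_insert a I) D₂
      (fun v hv => (h₂ v hv).1) (fun v hv => (h₂ v hv).2)
    obtain ⟨e1, e2⟩ | ⟨e1, e2⟩ := hcard <;> rw [e1] at h1 <;> rw [e2] at h2 <;>
      norm_num [base] at * <;> linarith
  have hnb : ∀ v, Undecided C I v → ∃ w, Undecided C I w ∧ G.Adj v w := by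
    intro v hv
    by_contra hn
    exact hZ v ⟨hv, hn⟩
  have fa : a ∉ freeSet G (insert a C) (insert c I) :=
    not_mem_freeSet_of_mem_left (Set.mem_insert a C)
  have fc : c ∉ freeSet G (insert a C) (insert c I) :=
    not_mem_freeSet_of_mem_right (Set.mem_insert c I)
  have fa' : a ∉ freeSet G C (insert a I) := not_mem_freeSet_of_mem_right (Set.mem_insert a I)
  by_cases hac : G.Adj a c
  · obtain ⟨w, hw, hwc, haw⟩ := h.resolve_left (not_not_intro hac)
    refine key {a, c} {a, c, w} (Or.inr ⟨Finset.card_pair hne,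
      Finset.card_eq_three.2 ⟨a, c, w, hne, haw.ne, Ne.symm hwc, rfl⟩⟩) ?_ ?_
    · simp [free ha, free hc, fa, fc]
    · simp [free ha, free hc, free hw, fa', not_mem_freeSet_of_adj (Set.mem_insert a I) hac,
        not_mem_freeSet_of_adj (Set.mem_insert a I) haw]
  · obtain ⟨w, hw, haw⟩ := hnb a ha
    obtain ⟨z, hz, hcz⟩ := hnb c hc
    have hza : a ≠ z := fun e => hac (e ▸ hcz).symm
    refine key {a, c, z} {a, w} (Or.inl ⟨Finset.card_eq_three.2 ⟨a, c, z, hne, hza, hcz.ne, rfl⟩,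
      Finset.card_pair haw.ne⟩) ?_ ?_
    · simp [free ha, free hc, free hz, fa, fc, not_mem_freeSet_of_adj (Set.mem_insert c I) hcz]
    · simp [free ha, free hw, fa', not_mem_freeSet_of_adj (Set.mem_insert a I) haw]

/-- Branching on a vertex `b` with three undecided neighbours. Putting `b` into `I` settles four
vertices. Putting `b` into `C` may settle `b` only, but it makes two nonadjacent neighbours an
exclusive pair, and so earns the discount in the weight. -/
theorem potential_branchVertex [Fintype V] [DecidableEq V] (hFC : ∀ v, ¬ ForcedCluster G C I v)
    (hFI : ∀ v, ¬ ForcedIndep G C I v) (hP : ∀ a c, ¬ BranchPair G C I a c) {b : V}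
    (h : BranchVertex G C I b) :
    potential G (insert b C) I + potential G C (insert b I) + 1 ≤ potential G C I := by
  obtain ⟨hb, a, c, d, ha, hc, hd, hba, hbc, hbd, hac, hac', had, hcd⟩ := h
  have free : ∀ {v}, Undecided C I v → v ∈ freeSet G C I := fun hv => hv.mem_freeSet hFC hFI
  have hW : weight G C I = base ^ (freeSet G C I).ncard := by
    rw [weight, if_neg, one_mul]
    rintro ⟨a, c, p, ha, hc, hp, h3⟩
    -- Such a pair would be a `BranchPair`, so there is no discount to give up.
    exact hP a c ⟨⟨ha.1, hc.1, p, hp, Or.inr (Or.inl ⟨h3.2.1.symm, h3.1.symm,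
      fun h => h3.2.2.1 h.symm, fun e => h3.2.2.2 e.symm⟩)⟩, Or.inl h3.2.2.1⟩
  apply potential_add_potential_le
  rw [hW]
  have h2 := weight_mul_le (G := G) (subset_refl C) (Set.subset_insert b I) {b, a, c, d}
    (by simp [free ha, free hb, free hc, free hd])
    (by
      simp [not_mem_freeSet_of_mem_right (Set.mem_insert b I),
        not_mem_freeSet_of_adj (Set.mem_insert b I) hba,
        not_mem_freeSet_of_adj (Set.mem_insert b I) hbc,
        not_mem_freeSet_of_adj (Set.mem_insert b I) hbd])
  have e2 : Finset.card {b, a, c, d} = 4 := by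
    rw [Finset.card_insert_of_notMem (by simp [hba.ne, hbc.ne, hbd.ne]),
      Finset.card_eq_three.2 ⟨a, c, d, hac', had, hcd, rfl⟩]
  rw [e2] at h2
  have fb : b ∉ freeSet G (insert b C) I := not_mem_freeSet_of_mem_left (Set.mem_insert b C)
  have hk := one_le_base_pow (freeSet G C I).ncard
  -- A neighbour that stops being free makes the first branch cheap as well.
  have key : ∀ u, Undecided C I u → b ≠ u → u ∉ freeSet G (insert b C) I →
      weight G (insert b C) I + weight G C (insert b I) ≤ base ^ (freeSet G C I).ncard := by
    intro u hu hbu hu'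
    have h1 := weight_mul_le (G := G) (Set.subset_insert b C) (subset_refl I) {b, u}
      (by simp [free hb, free hu]) (by simp [fb, hu'])
    rw [Finset.card_pair hbu] at h1
    norm_num [base] at *
    linarith
  by_cases ha' : a ∈ freeSet G (insert b C) I
  · by_cases hc' : c ∈ freeSet G (insert b C) I
    · have hD : HasFreePair G (insert b C) I :=
        ⟨a, c, b, ha', hc', Set.mem_insert b C, hba.symm, hbc, hac, hac'⟩
      have h1 := base_pow_ncard_mul_le (G := G) (Set.subset_insert b C) (subset_refl I) {b}
        (by simp [free hb]) (by simp [fb])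
      have h1' : weight G (insert b C) I = 0.917 * base ^ (freeSet G (insert b C) I).ncard := by
        rw [weight, if_pos hD]
      rw [h1']
      rw [Finset.card_singleton] at h1
      norm_num [base] at *
      linarith
    · exact key c hc hbc.ne hc'
  · exact key a ha hba.ne ha'

end Measure

/-! ### Running times of programs -/

/-- Started in `s`, the program `p` halts within `T` steps in a state with property `Q`. -/
def Runs (p : Prog) (s : State) (T : ℕ) (Q : State → Prop) : Prop :=
  ∃ t s', Exec p s t s' ∧ t ≤ T ∧ Q s'

section Runs

variable {p q : Prog} {s : State} {T T₁ T₂ : ℕ} {Q R : State → Prop}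

theorem Runs.mono (h : Runs p s T₁ Q) (hT : T₁ ≤ T₂) (hQ : ∀ s', Q s' → R s') :
    Runs p s T₂ R := by
  obtain ⟨t, s', he, ht, hs⟩ := h
  exact ⟨t, s', he, ht.trans hT, hQ s' hs⟩

theorem Runs.seq (hp : Runs p s T₁ R) (hq : ∀ s', R s' → Runs q s' T₂ Q) :
    Runs (.seq p q) s (T₁ + T₂) Q := by
  obtain ⟨t, s', he, ht, hs⟩ := hp
  obtain ⟨t', s'', he', ht', hs'⟩ := hq s' hs
  exact ⟨_, s'', .seq he he', Nat.add_le_add ht ht', hs'⟩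

theorem Runs.skip (h : Q s) : Runs .skip s 1 Q := ⟨1, s, .skip s, le_rfl, h⟩

theorem Runs.const {x k : ℕ} (h : Q (s.setReg x k)) : Runs (.const x k) s 1 Q :=
  ⟨1, _, .const x k s, le_rfl, h⟩

theorem Runs.copy {x y : ℕ} (h : Q (s.setReg x (s.reg y))) : Runs (.copy x y) s 1 Q :=
  ⟨1, _, .copy x y s, le_rfl, h⟩

theorem Runs.succ {x : ℕ} (h : Q (s.setReg x (s.reg x + 1))) : Runs (.succ x) s 1 Q :=
  ⟨1, _, .succ x s, le_rfl, h⟩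

theorem Runs.sub {x y z : ℕ} (h : Q (s.setReg x (s.reg y - s.reg z))) :
    Runs (.sub x y z) s 1 Q :=
  ⟨1, _, .sub x y z s, le_rfl, h⟩

theorem Runs.load {x a i : ℕ} (h : Q (s.setReg x (s.mem a (s.reg i)))) :
    Runs (.load x a i) s 1 Q :=
  ⟨1, _, .load x a i s, le_rfl, h⟩

theorem Runs.store {a i x : ℕ} (h : Q (s.setMem a (s.reg i) (s.reg x))) :
    Runs (.store a i x) s 1 Q :=
  ⟨1, _, .store a i x s, le_rfl, h⟩

/-- Sequencing in the form that suits straight-line code: one step, then the rest. -/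
theorem Runs.cons (hp : Runs p s 1 fun s' => Runs q s' T Q) : Runs (.seq p q) s (T + 1) Q :=
  (hp.seq fun _ h => h).mono (Nat.add_comm 1 T).le fun _ h => h

theorem Runs.cond {x : ℕ} (hp : s.reg x ≠ 0 → Runs p s T Q) (hq : s.reg x = 0 → Runs q s T Q) :
    Runs (.cond x p q) s (T + 1) Q := by
  by_cases hx : s.reg x = 0
  · obtain ⟨t, s', he, ht, hs⟩ := hq hx
    exact ⟨_, s', .cond_false hx he, Nat.succ_le_succ ht, hs⟩
  · obtain ⟨t, s', he, ht, hs⟩ := hp hx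
    exact ⟨_, s', .cond_true hx he, Nat.succ_le_succ ht, hs⟩

theorem Runs.loop_of_eq_zero {x : ℕ} (hx : s.reg x = 0) (h : Q s) : Runs (.loop x p) s 1 Q :=
  ⟨1, s, by constructor; exact hx, le_rfl, h⟩

theorem Runs.loop_of_ne_zero {x : ℕ} (hx : s.reg x ≠ 0)
    (h : Runs p s T₁ fun s' => Runs (.loop x p) s' T₂ Q) :
    Runs (.loop x p) s (T₁ + T₂ + 1) Q := by
  obtain ⟨t, s', he, ht, t', s'', he', ht', hs⟩ := h
  exact ⟨_, s'', .loop_step hx he he', by omega, hs⟩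

/-- The rule for a loop: each round takes at most `T` steps and decreases the bound `k` in the
invariant `Inv`. -/
theorem Runs.loop {x : ℕ} (Inv : ℕ → State → Prop)
    (hzero : ∀ k s, Inv k s → s.reg x = 0 → Q s)
    (hstep : ∀ k s, Inv k s → s.reg x ≠ 0 → Runs p s T fun s' => ∃ k' < k, Inv k' s')
    (k : ℕ) (h : Inv k s) : Runs (.loop x p) s (k * (T + 1) + 1) Q := by
  induction k using Nat.strong_induction_on generalizing s with
  | _ k ih =>
    by_cases hx : s.reg x = 0
    · exact (Runs.loop_of_eq_zero hx (hzero k s h hx)).mono (by omega) fun _ h => h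
    · obtain ⟨t, s', he, ht, k', hk, h'⟩ := hstep k s h hx
      have hrec := Runs.loop_of_ne_zero (T₁ := T) hx ⟨t, s', he, ht, ih k' hk h'⟩
      refine hrec.mono ?_ fun _ h => h
      have : (k' + 1) * (T + 1) ≤ k * (T + 1) := Nat.mul_le_mul_right _ hk
      nlinarith

end Runs

@[simp] theorem State.reg_setReg (s : State) (x v y : ℕ) :
    (s.setReg x v).reg y = if y = x then v else s.reg y := Function.update_apply ..

@[simp] theorem State.mem_setReg (s : State) (x v : ℕ) : (s.setReg x v).mem = s.mem := rfl

@[simp] theorem State.reg_setMem (s : State) (a i v : ℕ) : (s.setMem a i v).reg = s.reg := rfl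

@[simp] theorem State.mem_setMem (s : State) (a i v b j : ℕ) :
    (s.setMem a i v).mem b j = if b = a ∧ j = i then v else s.mem b j := by
  unfold State.setMem
  simp only [Function.update_apply]
  split_ifs <;> simp_all

/-- Run `p` with register `x` counting from `0` to `n - 1`, where `n` is the content of register
`0`; register `y` holds the number of remaining rounds. -/
def forLoop (x y : ℕ) (p : Prog) : Prog :=
  .seq (.const x 0) (.seq (.sub y 0 x) (.loop y (.seq p (.seq (.succ x) (.sub y 0 x)))))

theorem Runs.forLoop {x y n T : ℕ} {p : Prog} {s : State} {Q : State → Prop}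
    (hx : x ≠ 0) (hy : y ≠ 0) (hxy : x ≠ y) (hn : s.reg 0 = n) (Inv : ℕ → State → Prop)
    (h0 : Inv 0 ((s.setReg x 0).setReg y n))
    (hQ : ∀ s, s.reg 0 = n → Inv n s → Q s)
    (hstep : ∀ i s, i < n → s.reg 0 = n → s.reg x = i → Inv i s → Runs p s T fun s' =>
      s'.reg 0 = n ∧ s'.reg x = i ∧ Inv (i + 1) ((s'.setReg x (i + 1)).setReg y (n - (i + 1)))) :
    Runs (forLoop x y p) s (n * (T + 3) + 3) Q := by
  refine Runs.cons (Runs.const (Runs.cons (Runs.sub ?_)))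
  refine Runs.loop (T := T + 2)
    (fun k s => ∃ i, i + k = n ∧ s.reg 0 = n ∧ s.reg x = i ∧ s.reg y = n - i ∧ Inv i s) ?_ ?_ n ?_
  · rintro k s ⟨i, hik, hn, -, hyi, hI⟩ hz
    obtain rfl : i = n := by omega
    exact hQ s hn hI
  · rintro k s ⟨i, hik, hn, hxi, hyi, hI⟩ hz
    refine (hstep i s (by omega) hn hxi hI).seq (T₂ := 2) ?_
    rintro s' ⟨hn', hxi', hI'⟩
    refine Runs.cons (Runs.succ (Runs.sub ⟨k - 1, by omega, i + 1, by omega, ?_⟩))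
    simp [hx.symm, hy.symm, hxy, hn', hxi', hI']
  · refine ⟨0, by omega, ?_⟩
    simp [hx.symm, hy.symm, hxy, hn]
    simpa [hx.symm, hn] using h0

/-! ### Evaluation of first-order formulas -/

/-- Add register `3` to register `x`, using that register `5` holds `1`. -/
def addReg (x : ℕ) : Prog := .loop 3 (.seq (.succ x) (.sub 3 3 5))

theorem Runs.addReg {x : ℕ} {s : State} (hx : x ≠ 3) (hx' : x ≠ 5) (h5 : s.reg 5 = 1) :
    Runs (addReg x) s (s.reg 3 * 3 + 1) fun s' => s'.mem = s.mem ∧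
      s'.reg x = s.reg x + s.reg 3 ∧ ∀ r, r ≠ x → r ≠ 3 → s'.reg r = s.reg r := by
  refine Runs.loop (T := 2) (fun k s' => s'.reg 3 = k ∧ s'.mem = s.mem ∧
    s'.reg x + k = s.reg x + s.reg 3 ∧ ∀ r, r ≠ x → r ≠ 3 → s'.reg r = s.reg r) ?_ ?_ _ ?_
  · rintro k s' ⟨h1, h2, h3, h4⟩ hz
    exact ⟨h2, by omega, h4⟩
  · rintro k s' ⟨h1, h2, h3, h4⟩ hz
    have h5' : s'.reg 5 = 1 := (h4 5 hx'.symm (by decide)).trans h5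
    refine Runs.cons (Runs.succ (Runs.sub ⟨k - 1, by omega, ?_⟩))
    simp only [State.reg_setReg, State.mem_setReg, hx, hx.symm, hx'.symm, if_true, if_false,
      h1, h5', h2, true_and]
    refine ⟨by omega, fun r hr hr' => ?_⟩
    simp [hr, hr', h4 r hr hr']
  · simp

/-- Compute in register `1` the value of the cell of array `0` for row `x` and column `y`. -/
def loadAdj (x y : ℕ) : Prog :=
  .seq (.const 5 1) (.seq (.const 1 0) (.seq (.copy 2 x) (.seq
    (.loop 2 (.seq (.copy 3 0) (.seq (addReg 1) (.sub 2 2 5))))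
    (.seq (.copy 3 y) (.seq (addReg 1) (.load 1 0 1))))))

theorem Runs.loadAdj {x y n : ℕ} {s : State} (hx : 6 ≤ x) (hy : 6 ≤ y) (hn : s.reg 0 = n)
    (hxn : s.reg x ≤ n) (hyn : s.reg y ≤ n) :
    Runs (loadAdj x y) s (n * (n * 3 + 4) + n * 3 + 8) fun s' => s'.mem = s.mem ∧
      s'.reg 1 = s.mem 0 (s.reg x * n + s.reg y) ∧
      ∀ r, (r = 0 ∨ 6 ≤ r) → s'.reg r = s.reg r := by
  refine (Runs.cons (Runs.const (Runs.cons (Runs.const (Runs.cons (Runs.copy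
    (Runs.seq (Runs.loop (T := n * 3 + 3) (fun k s' => s'.reg 2 = k ∧ s'.mem = s.mem ∧
      s'.reg 5 = 1 ∧ s'.reg 1 + k * n = s.reg x * n ∧
      ∀ r, (r = 0 ∨ 6 ≤ r) → s'.reg r = s.reg r) (Q := fun s' => s'.mem = s.mem ∧
      s'.reg 5 = 1 ∧ s'.reg 1 = s.reg x * n ∧
      ∀ r, (r = 0 ∨ 6 ≤ r) → s'.reg r = s.reg r) ?_ ?_ (s.reg x) ?_)
      (T₂ := n * 3 + 3) ?_))))))).mono ?_ (fun _ h => h)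
  · rintro k s' ⟨h1, h2, h3, h4, h5⟩ hz
    obtain rfl : k = 0 := by omega
    exact ⟨h2, h3, by simpa using h4, h5⟩
  · rintro k s' ⟨h1, h2, h3, h4, h5⟩ hz
    refine Runs.cons (Runs.copy ?_)
    have h0 : s'.reg 0 = n := (h5 0 (Or.inl rfl)).trans hn
    refine (Runs.seq (Runs.addReg (by decide) (by decide) (by simp [h3])) (T₂ := 1) ?_).mono
      (T₂ := n * 3 + 2) (by simp [h0]) (fun _ h => h)
    rintro s'' ⟨g1, g2, g3⟩
    refine Runs.sub ⟨k - 1, by omega, ?_⟩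
    have e2 : s''.reg 2 = k := by rw [g3 2 (by decide) (by decide)]; simpa using h1
    have e5 : s''.reg 5 = 1 := by rw [g3 5 (by decide) (by decide)]; simpa using h3
    simp only [State.reg_setReg, State.mem_setReg, if_true, e2, e5, true_and]
    refine ⟨by simpa [g1] using h2, by simp, ?_, fun r hr => ?_⟩
    · obtain ⟨k, rfl⟩ : ∃ m, k = m + 1 := ⟨k - 1, by omega⟩
      simp [g2, h0]
      linarith
    · rw [if_neg (by omega), g3 r (by omega) (by omega)]
      simp [show r ≠ 3 by omega, h5 r hr]
  · simp [show x ≠ 1 by omega, show x ≠ 5 by omega]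
    intro r hr
    simp [show r ≠ 1 by omega, show r ≠ 2 by omega, show r ≠ 5 by omega]
  · rintro s' ⟨h1, h2, h3, h4⟩
    refine Runs.cons (Runs.copy ?_)
    have hy' : s'.reg y = s.reg y := h4 y (Or.inr hy)
    refine (Runs.seq (Runs.addReg (by decide) (by decide) (by simpa using h2)) (T₂ := 1) ?_).mono
      (T₂ := n * 3 + 2) (by simp [hy']; omega) (fun _ h => h)
    rintro s'' ⟨g1, g2, g3⟩
    refine Runs.load ⟨by simpa [g1] using h1, ?_, fun r hr => ?_⟩
    · simp [g2, g1, h1, h3, hy']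
    · simp only [State.reg_setReg]
      rw [if_neg (by omega), g3 r (by omega) (by omega)]
      simp [show r ≠ 3 by omega, h4 r hr]
  · have : s.reg x * (n * 3 + 3 + 1) ≤ n * (n * 3 + 4) := Nat.mul_le_mul hxn le_rfl
    omega

/-- First-order formulas with `k` free variables about a graph with two vertex sets. The variable
bound by `ex` is the last one of the formula below it. -/
inductive Fml : ℕ → Type where
  | adj {k : ℕ} (i j : Fin k) : Fml k
  | eq {k : ℕ} (i j : Fin k) : Fml k
  | inC {k : ℕ} (i : Fin k) : Fml k
  | inI {k : ℕ} (i : Fin k) : Fml k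
  | not {k : ℕ} (φ : Fml k) : Fml k
  | and {k : ℕ} (φ ψ : Fml k) : Fml k
  | or {k : ℕ} (φ ψ : Fml k) : Fml k
  | ex {k : ℕ} (φ : Fml (k + 1)) : Fml k

/-- Truth of a formula in a graph `G` with vertex sets `C` and `I`. -/
def Fml.Sat {V : Type*} (G : SimpleGraph V) (C I : Set V) : {k : ℕ} → Fml k → (Fin k → V) → Prop
  | _, .adj i j, e => G.Adj (e i) (e j)
  | _, .eq i j, e => e i = e j
  | _, .inC i, e => e i ∈ C
  | _, .inI i, e => e i ∈ I
  | _, .not φ, e => ¬ φ.Sat G C I e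
  | _, .and φ ψ, e => φ.Sat G C I e ∧ ψ.Sat G C I e
  | _, .or φ ψ, e => φ.Sat G C I e ∨ ψ.Sat G C I e
  | _, .ex φ, e => ∃ v, φ.Sat G C I (Fin.snoc (α := fun _ => V) e v)

/-- The memory `m` holds the graph `G` in array `0` and the vertex sets `C` and `I` in the arrays
`1` and `2`. -/
structure Encodes {n : ℕ} (m : ℕ → ℕ → ℕ) (G : SimpleGraph (Fin n)) (C I : Set (Fin n)) : Prop where
  adj : ∀ i j : Fin n, m 0 (i * n + j) ≠ 0 ↔ G.Adj i j
  left : ∀ v : Fin n, m 1 v = bit (v ∈ C)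
  right : ∀ v : Fin n, m 2 v = bit (v ∈ I)

theorem bit_ne_zero {P : Prop} : bit P ≠ 0 ↔ P := by
  unfold bit
  split_ifs <;> simp_all

theorem bit_of_true {P : Prop} (h : P) : bit P = 1 := if_pos h

theorem bit_of_false {P : Prop} (h : ¬ P) : bit P = 0 := if_neg h

/-- The register of the variable `i` of a formula. The next register is the loop counter of the
quantifier that binds the variable; registers `1` to `5` are scratch, and the registers `6` to `9`
are out of reach of formulas. -/
def varReg (i : ℕ) : ℕ := 2 * i + 10

/-- Search for a value below the content of register `0` for register `x` such that `p` leaves a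
nonzero value in register `1`. If there is one, then it remains in register `x`, and register `1` is
nonzero; otherwise register `1` is zero. Register `x + 1` controls the loop. -/
def search (x : ℕ) (p : Prog) : Prog :=
  .seq (.const x 0) (.seq (.sub (x + 1) 0 x) (.seq (.const 1 0) (.loop (x + 1) (.seq p
    (.cond 1 (.const (x + 1) 0) (.seq (.succ x) (.sub (x + 1) 0 x)))))))

theorem Runs.search {x n T : ℕ} {p : Prog} {s : State} (P : Fin n → Prop) (hx : 6 ≤ x)
    (hn : s.reg 0 = n)
    (hp : ∀ (v : Fin n) (s' : State), s'.mem = s.mem → s'.reg 0 = n → s'.reg x = v →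
      (∀ r, 6 ≤ r → r < x → s'.reg r = s.reg r) → Runs p s' T fun s'' => s''.mem = s'.mem ∧
        (s''.reg 1 ≠ 0 ↔ P v) ∧ ∀ r, (r = 0 ∨ 6 ≤ r ∧ r < x + 2) → s''.reg r = s'.reg r) :
    Runs (search x p) s (n * (T + 4) + 4) fun s' => s'.mem = s.mem ∧
      (s'.reg 1 ≠ 0 → ∃ v : Fin n, s'.reg x = v ∧ P v) ∧ (s'.reg 1 = 0 → ¬ ∃ v, P v) ∧
      ∀ r, (r = 0 ∨ 6 ≤ r ∧ r < x) → s'.reg r = s.reg r := by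
  refine Runs.cons (Runs.const (Runs.cons (Runs.sub (Runs.cons (Runs.const
    (Runs.loop (T := T + 3) (fun k s' => s'.mem = s.mem ∧
      (∀ r, (r = 0 ∨ 6 ≤ r ∧ r < x) → s'.reg r = s.reg r) ∧ s'.reg (x + 1) = k ∧
      ((s'.reg 1 ≠ 0 ∧ k = 0 ∧ ∃ v : Fin n, s'.reg x = v ∧ P v) ∨
        (s'.reg 1 = 0 ∧ s'.reg x + k = n ∧ ∀ v : Fin n, v < s'.reg x → ¬ P v))) ?_ ?_ n ?_))))))
  · rintro k s' ⟨h1, h2, h3, h4⟩ hz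
    refine ⟨h1, fun h => ?_, fun h => ?_, h2⟩
    · exact (h4.resolve_right fun h' => h h'.1).2.2
    · rintro ⟨v, hv⟩
      obtain ⟨-, h5, h6⟩ := h4.resolve_left fun h' => h'.1 h
      exact h6 v (by have := v.2; omega) hv
  · rintro k s' ⟨h1, h2, h3, h4⟩ hz
    obtain ⟨-, h5, h6⟩ := h4.resolve_left fun h' => hz (h3.trans h'.2.1)
    have h0 : s'.reg 0 = n := (h2 0 (Or.inl rfl)).trans hn
    have hlt : s'.reg x < n := by omega
    refine (hp ⟨s'.reg x, hlt⟩ s' h1 h0 rfl fun r hr hr' => h2 r (Or.inr ⟨hr, hr'⟩)).seq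
      (T₂ := 3) ?_
    rintro s'' ⟨g1, g2, g3⟩
    have gx : s''.reg x = s'.reg x := g3 x (by omega)
    have g0 : s''.reg 0 = n := (g3 0 (by omega)).trans h0
    have gr : ∀ r, (r = 0 ∨ 6 ≤ r ∧ r < x) → s''.reg r = s.reg r :=
      fun r hr => (g3 r (by omega)).trans (h2 r hr)
    refine Runs.cond (T := 2) (fun hz' => ?_) (fun hz' => ?_)
    · refine (Runs.const ⟨0, by omega, ?_⟩).mono (by omega) fun _ h => h
      refine ⟨g1.trans h1, fun r hr => ?_, by simp, Or.inl ⟨?_, rfl, ⟨s'.reg x, hlt⟩, ?_, g2.1 hz'⟩⟩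
      · simp [show r ≠ x + 1 by omega, gr r hr]
      · simpa [show x ≠ 0 by omega] using hz'
      · simpa using gx
    · refine Runs.cons (Runs.succ (Runs.sub ⟨k - 1, by omega, g1.trans h1, fun r hr => ?_, ?_,
        Or.inr ⟨?_, ?_, fun v hv => ?_⟩⟩))
      · simp [show r ≠ x + 1 by omega, show r ≠ x by omega, gr r hr]
      · simp [show 0 ≠ x by omega, g0, gx]
        omega
      · simpa [show x ≠ 0 by omega, show 1 ≠ x by omega] using hz'
      · simp [gx]
        omega
      · have hv : (v : ℕ) ≤ s'.reg x := by simpa [gx, Nat.lt_succ_iff] using hv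
        obtain hv' | hv' := hv.lt_or_eq
        · exact h6 v hv'
        · intro hPv
          refine g2.2 ?_ hz'
          convert hPv
          exact hv'.symm
  · refine ⟨rfl, fun r hr => ?_, ?_, Or.inr ?_⟩
    · simp [show r ≠ 1 by omega, show r ≠ x by omega, show r ≠ x + 1 by omega]
    · simp [show x ≠ 0 by omega, show 0 ≠ x by omega, hn]
    · simp [show x ≠ 1 by omega]

/-- The program that leaves the truth value of a formula in register `1`. -/
def Fml.compile : {k : ℕ} → Fml k → Prog
  | _, .adj i j => loadAdj (varReg i) (varReg j)
  | _, .eq i j => .seq (.sub 1 (varReg i) (varReg j)) (.seq (.sub 2 (varReg j) (varReg i))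
      (.cond 1 (.const 1 0) (.cond 2 (.const 1 0) (.const 1 1))))
  | _, .inC i => .load 1 1 (varReg i)
  | _, .inI i => .load 1 2 (varReg i)
  | _, .not φ => .seq φ.compile (.cond 1 (.const 1 0) (.const 1 1))
  | _, .and φ ψ => .seq φ.compile (.cond 1 ψ.compile .skip)
  | _, .or φ ψ => .seq φ.compile (.cond 1 .skip ψ.compile)
  | k, .ex φ => search (varReg k) φ.compile

/-- A bound for the running time of a compiled formula on a graph with `n` vertices. -/
def Fml.time (n : ℕ) : {k : ℕ} → Fml k → ℕ
  | _, .adj _ _ => n * (n * 3 + 4) + n * 3 + 8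
  | _, .eq _ _ => 5
  | _, .inC _ => 1
  | _, .inI _ => 1
  | _, .not φ => φ.time n + 2
  | _, .and φ ψ => φ.time n + (ψ.time n + 2)
  | _, .or φ ψ => φ.time n + (ψ.time n + 2)
  | _, .ex φ => n * (φ.time n + 4) + 4

/-- What the evaluation of a formula with `k` free variables leaves unchanged. -/
def Preserves (k : ℕ) (s s' : State) : Prop :=
  s'.mem = s.mem ∧ ∀ r, (r = 0 ∨ 6 ≤ r ∧ r < varReg k) → s'.reg r = s.reg r

theorem Preserves.trans {k : ℕ} {s₁ s₂ s₃ : State} (h : Preserves k s₁ s₂)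
    (h' : Preserves k s₂ s₃) : Preserves k s₁ s₃ :=
  ⟨h'.1.trans h.1, fun r hr => (h'.2 r hr).trans (h.2 r hr)⟩

theorem Preserves.setReg {k x v : ℕ} {s s' : State} (h : Preserves k s s') (hx : 1 ≤ x)
    (hx' : x < 6) : Preserves k s (s'.setReg x v) :=
  ⟨h.1, fun r hr => by simp [show r ≠ x by omega, h.2 r hr]⟩

theorem Preserves.refl (k : ℕ) (s : State) : Preserves k s s := ⟨rfl, fun _ _ => rfl⟩

section Compile

variable {n k : ℕ} {G : SimpleGraph (Fin n)} {C I : Set (Fin n)}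

/-- The search for a witness of `φ`, given that the compiled `φ` is correct. -/
theorem Fml.runs_search (φ : Fml (k + 1))
    (hφ : ∀ (e : Fin (k + 1) → Fin n) (s : State), s.reg 0 = n → Encodes s.mem G C I →
      (∀ i : Fin (k + 1), s.reg (varReg i) = e i) → Runs φ.compile s (φ.time n) fun s' =>
        (s'.reg 1 ≠ 0 ↔ φ.Sat G C I e) ∧ Preserves (k + 1) s s')
    (e : Fin k → Fin n) (s : State) (hn : s.reg 0 = n)
    (hs : Encodes s.mem G C I) (he : ∀ i : Fin k, s.reg (varReg i) = e i) :
    Runs φ.ex.compile s (φ.ex.time n) fun s' => Preserves k s s' ∧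
      (s'.reg 1 ≠ 0 → ∃ v : Fin n, s'.reg (varReg k) = v ∧
        φ.Sat G C I (Fin.snoc (α := fun _ => Fin n) e v)) ∧
      (s'.reg 1 = 0 → ∀ v, ¬ φ.Sat G C I (Fin.snoc (α := fun _ => Fin n) e v)) := by
  refine (Runs.search (T := φ.time n)
    (fun v => φ.Sat G C I (Fin.snoc (α := fun _ => Fin n) e v)) (by unfold varReg; omega) hn
    ?_).mono le_rfl ?_
  · intro v s' h1 h2 h3 h4
    refine (hφ _ s' h2 (h1 ▸ hs) fun i => ?_).mono le_rfl
      fun s'' h => ⟨h.2.1, h.1, h.2.2⟩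
    refine Fin.lastCases ?_ (fun i => ?_) i
    · simpa using h3
    · simpa using (h4 _ (by unfold varReg; omega) (by unfold varReg; omega)).trans (he i)
  · rintro s' ⟨h1, h2, h3, h4⟩
    exact ⟨⟨h1, h4⟩, h2, fun h v hv => h3 h ⟨v, hv⟩⟩

theorem Fml.runs_compile (φ : Fml k) (e : Fin k → Fin n) (s : State) (hn : s.reg 0 = n)
    (hs : Encodes s.mem G C I) (he : ∀ i : Fin k, s.reg (varReg i) = e i) :
    Runs φ.compile s (φ.time n) fun s' => (s'.reg 1 ≠ 0 ↔ φ.Sat G C I e) ∧ Preserves k s s' := by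
  induction φ generalizing s with
  | adj i j =>
    refine (Runs.loadAdj (by simp [varReg]) (by simp [varReg]) hn (he i ▸ (e i).2.le)
      (he j ▸ (e j).2.le)).mono le_rfl ?_
    rintro s' ⟨h1, h2, h3⟩
    refine ⟨?_, h1, fun r hr => h3 r (by omega)⟩
    rw [h2, he, he]
    exact hs.adj _ _
  | eq i j =>
    have h : (e i = e j) ↔ ((e i : ℕ) - e j = 0 ∧ (e j : ℕ) - e i = 0) := by
      rw [Fin.ext_iff]
      omega
    have hj : varReg j ≠ 1 := by unfold varReg; omega
    have hi : varReg i ≠ 1 := by unfold varReg; omega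
    have P := Preserves.refl
    refine Runs.cons (Runs.sub (Runs.cons (Runs.sub (Runs.cond (fun h1 => ?_) fun h1 =>
      Runs.cond (fun h2 => ?_) fun h2 => ?_))))
    · refine (Runs.const ⟨?_, (((P _ s).setReg ?_ ?_).setReg ?_ ?_).setReg ?_ ?_⟩).mono
        (T₁ := 1) (by omega) fun _ h => h
      all_goals first | decide | skip
      simp [he] at h1
      simp [Fml.Sat, h]
      omega
    · refine Runs.const ⟨?_, (((P _ s).setReg ?_ ?_).setReg ?_ ?_).setReg ?_ ?_⟩
      all_goals first | decide | skip
      simp [he, hi, hj] at h2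
      simp [Fml.Sat, h]
      omega
    · refine Runs.const ⟨?_, (((P _ s).setReg ?_ ?_).setReg ?_ ?_).setReg ?_ ?_⟩
      all_goals first | decide | skip
      simp [he, hi, hj] at h1 h2
      simp [Fml.Sat, h]
      omega
  | inC i =>
    refine Runs.load ⟨?_, (Preserves.refl _ s).setReg (by decide) (by decide)⟩
    simp only [State.reg_setReg, if_true, he, hs.left, bit_ne_zero]
    rfl
  | inI i =>
    refine Runs.load ⟨?_, (Preserves.refl _ s).setReg (by decide) (by decide)⟩
    simp only [State.reg_setReg, if_true, he, hs.right, bit_ne_zero]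
    rfl
  | not φ ih =>
    refine (ih e s hn hs he).seq ?_
    rintro s' ⟨h1, h2⟩
    refine Runs.cond (fun hz => Runs.const ⟨?_, h2.setReg (by decide) (by decide)⟩)
      fun hz => Runs.const ⟨?_, h2.setReg (by decide) (by decide)⟩
    · simpa [Fml.Sat] using h1.1 hz
    · simpa [Fml.Sat] using fun h => h1.2 h hz
  | and φ ψ ih₁ ih₂ =>
    refine (ih₁ e s hn hs he).seq ?_
    rintro s' ⟨h1, h2⟩
    refine Runs.cond (fun hz => ?_) fun hz => ?_
    · refine (ih₂ e s' ((h2.2 0 (by omega)).trans hn) (h2.1 ▸ hs)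
        fun i => (h2.2 _ (by unfold varReg; omega)).trans (he i)).mono (by omega) ?_
      rintro s'' ⟨h3, h4⟩
      exact ⟨h3.trans (by simp [Fml.Sat, h1.1 hz]), h2.trans h4⟩
    · refine (Runs.skip ⟨?_, h2⟩).mono (by omega) fun _ h => h
      simp only [Fml.Sat, ← h1, hz]
      simp
  | or φ ψ ih₁ ih₂ =>
    refine (ih₁ e s hn hs he).seq ?_
    rintro s' ⟨h1, h2⟩
    refine Runs.cond (fun hz => ?_) fun hz => ?_
    · refine (Runs.skip ⟨?_, h2⟩).mono (by omega) fun _ h => h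
      simp only [Fml.Sat, ← h1]
      simp [hz]
    · refine (ih₂ e s' ((h2.2 0 (by omega)).trans hn) (h2.1 ▸ hs)
        fun i => (h2.2 _ (by unfold varReg; omega)).trans (he i)).mono (by omega) ?_
      rintro s'' ⟨h3, h4⟩
      refine ⟨h3.trans ?_, h2.trans h4⟩
      simp only [Fml.Sat, ← h1, hz]
      simp
  | ex φ ih =>
    refine (φ.runs_search ih e s hn hs he).mono le_rfl ?_
    rintro s' ⟨h1, h2, h3⟩
    refine ⟨⟨fun h => ?_, fun ⟨v, hv⟩ h => h3 h v hv⟩, h1⟩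
    obtain ⟨v, -, hv⟩ := h2 h
    exact ⟨v, hv⟩

/-- A quantified formula finds a witness. -/
theorem Fml.runs_compile_ex (φ : Fml (k + 1)) (e : Fin k → Fin n) (s : State) (hn : s.reg 0 = n)
    (hs : Encodes s.mem G C I) (he : ∀ i : Fin k, s.reg (varReg i) = e i) :
    Runs φ.ex.compile s (φ.ex.time n) fun s' => Preserves k s s' ∧
      (s'.reg 1 ≠ 0 → ∃ v : Fin n, s'.reg (varReg k) = v ∧
        φ.Sat G C I (Fin.snoc (α := fun _ => Fin n) e v)) ∧
      (s'.reg 1 = 0 → ∀ v, ¬ φ.Sat G C I (Fin.snoc (α := fun _ => Fin n) e v)) :=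
  φ.runs_search φ.runs_compile e s hn hs he

end Compile

theorem Fml.exists_polynomial {k : ℕ} (φ : Fml k) :
    ∃ q : Polynomial ℕ, ∀ n, φ.time n = q.eval n := by
  induction φ with
  | adj => exact ⟨.X * (.X * 3 + 4) + .X * 3 + 8, by simp [Fml.time]⟩
  | eq => exact ⟨5, by simp [Fml.time]⟩
  | inC => exact ⟨1, by simp [Fml.time]⟩
  | inI => exact ⟨1, by simp [Fml.time]⟩
  | not φ ih =>
    obtain ⟨q, hq⟩ := ih
    exact ⟨q + 2, by simp [Fml.time, hq]⟩
  | and φ ψ ih₁ ih₂ | or φ ψ ih₁ ih₂ =>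
    obtain ⟨q₁, h₁⟩ := ih₁
    obtain ⟨q₂, h₂⟩ := ih₂
    exact ⟨q₁ + (q₂ + 2), by simp [Fml.time, h₁, h₂]⟩
  | ex φ ih =>
    obtain ⟨q, hq⟩ := ih
    exact ⟨.X * (q + 4) + 4, by simp [Fml.time, hq]⟩

/-! ### The rules as formulas

Each formula mirrors the definition of the predicate of the same name, so the lemmas `sat_*` hold
by definition. -/

namespace Fml

variable {k : ℕ}

def path3 (i j l : Fin k) : Fml k :=
  .and (.adj i j) (.and (.adj j l) (.and (.not (.adj i l)) (.not (.eq i l))))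

def inducesPath3 (i j l : Fin k) : Fml k :=
  .or (path3 i j l) (.or (path3 j l i) (path3 l i j))

def undecided (i : Fin k) : Fml k := .and (.not (.inC i)) (.not (.inI i))

def conflict : Fml 0 :=
  .or (.ex (.and (.inC 0) (.inI 0)))
    (.or (.ex (.ex (.and (.inI 0) (.and (.inI 1) (.adj 0 1)))))
      (.ex (.ex (.ex (.and (.inC 0) (.and (.inC 1) (.and (.inC 2) (path3 0 1 2))))))))

def forcedCluster : Fml 1 := .and (undecided 0) (.ex (.and (.inI 1) (.adj 1 0)))

def forcedIndep : Fml 1 :=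
  .and (undecided 0) (.ex (.ex (.and (.inC 1) (.and (.inC 2) (inducesPath3 0 1 2)))))

def isolated : Fml 1 := .and (undecided 0) (.not (.ex (.and (undecided 1) (.adj 0 1))))

def branchPair : Fml 2 :=
  .and (.and (undecided 0) (.and (undecided 1) (.ex (.and (.inC 2) (inducesPath3 0 1 2)))))
    (.or (.not (.adj 0 1)) (.ex (.and (undecided 2) (.and (.not (.eq 2 1)) (.adj 0 2)))))

def branchVertex : Fml 1 :=
  .and (undecided 0) (.ex (.ex (.ex (.and (undecided 1) (.and (undecided 2) (.and (undecided 3)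
    (.and (.adj 0 1) (.and (.adj 0 2) (.and (.adj 0 3) (.and (.not (.adj 1 2))
      (.and (.not (.eq 1 2)) (.and (.not (.eq 1 3)) (.not (.eq 2 3))))))))))))))

variable {V : Type*} {G : SimpleGraph V} {C I : Set V}

theorem sat_conflict {e : Fin 0 → V} : conflict.Sat G C I e ↔ Conflict G C I := Iff.rfl

theorem sat_undecided {e : Fin 0 → V} {v : V} :
    (undecided 0).Sat G C I (Fin.snoc (α := fun _ => V) e v) ↔ Undecided C I v := Iff.rfl

theorem sat_forcedCluster {e : Fin 0 → V} {v : V} :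
    forcedCluster.Sat G C I (Fin.snoc (α := fun _ => V) e v) ↔ ForcedCluster G C I v := Iff.rfl

theorem sat_forcedIndep {e : Fin 0 → V} {v : V} :
    forcedIndep.Sat G C I (Fin.snoc (α := fun _ => V) e v) ↔ ForcedIndep G C I v := Iff.rfl

theorem sat_isolated {e : Fin 0 → V} {v : V} :
    isolated.Sat G C I (Fin.snoc (α := fun _ => V) e v) ↔ Isolated G C I v := Iff.rfl

theorem sat_branchPair {e : Fin 1 → V} {v : V} :
    branchPair.Sat G C I (Fin.snoc (α := fun _ => V) e v) ↔ BranchPair G C I (e 0) v := Iff.rfl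

theorem sat_branchVertex {e : Fin 0 → V} {v : V} :
    branchVertex.Sat G C I (Fin.snoc (α := fun _ => V) e v) ↔ BranchVertex G C I v := Iff.rfl

end Fml

/-! ### The stack of pending pairs -/

/-- The arrays `3` and `4` of the memory `m` hold the stack `L` of pairs of vertex sets, with the
top of the stack first in the list. Each pair occupies `n` cells, and `sp` is the number of cells
in use. -/
def HoldsStack {n : ℕ} (m : ℕ → ℕ → ℕ) : ℕ → List (Set (Fin n) × Set (Fin n)) → Prop
  | sp, [] => sp = 0
  | sp, P :: L => ∃ sp', sp = sp' + n ∧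
      (∀ v : Fin n, m 3 (sp' + v) = bit (v ∈ P.1) ∧ m 4 (sp' + v) = bit (v ∈ P.2)) ∧
      HoldsStack m sp' L

theorem HoldsStack.congr {n : ℕ} {m m' : ℕ → ℕ → ℕ} {L : List (Set (Fin n) × Set (Fin n))} :
    ∀ {sp : ℕ}, HoldsStack m sp L → (∀ j < sp, m' 3 j = m 3 j ∧ m' 4 j = m 4 j) →
      HoldsStack m' sp L := by
  induction L with
  | nil => exact fun h _ => h
  | cons P L ih =>
    rintro sp ⟨sp', rfl, h1, h2⟩ h
    refine ⟨sp', rfl, fun v => ?_, ih h2 fun j hj => h j (by omega)⟩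
    rw [(h (sp' + v) (by omega)).1, (h (sp' + v) (by omega)).2]
    exact h1 v

/-- Copy the current pair to the top of the stack, whose size is in register `6`. -/
def push : Prog :=
  .seq (.copy 4 6) (.seq
    (forLoop 2 3 (.seq (.load 5 1 2) (.seq (.store 3 4 5) (.seq (.load 5 2 2)
      (.seq (.store 4 4 5) (.succ 4))))))
    (.copy 6 4))

/-- Replace the current pair by the one on the top of the stack. -/
def pop : Prog :=
  .seq (.sub 6 6 0) (.seq (.copy 4 6)
    (forLoop 2 3 (.seq (.load 5 3 4) (.seq (.store 1 2 5) (.seq (.load 5 4 4)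
      (.seq (.store 2 2 5) (.succ 4)))))))

theorem Runs.push {n : ℕ} {s : State} (hn : s.reg 0 = n) :
    Runs push s (n * 8 + 5) fun s' =>
      (∀ r, (r = 0 ∨ 7 ≤ r) → s'.reg r = s.reg r) ∧ s'.reg 6 = s.reg 6 + n ∧
      ∀ a j, s'.mem a j =
        if a = 3 ∧ s.reg 6 ≤ j ∧ j < s.reg 6 + n then s.mem 1 (j - s.reg 6)
        else if a = 4 ∧ s.reg 6 ≤ j ∧ j < s.reg 6 + n then s.mem 2 (j - s.reg 6)
        else s.mem a j := by
  refine Runs.cons (Runs.copy (Runs.seq (T₁ := n * 8 + 3) (T₂ := 1)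
    (Runs.forLoop (n := n) (T := 5) (by decide) (by decide) (by decide) (by simpa using hn)
    (fun i s' => s'.reg 4 = s.reg 6 + i ∧ (∀ r, (r = 0 ∨ 6 ≤ r) → s'.reg r = s.reg r) ∧
      ∀ a j, s'.mem a j =
        if a = 3 ∧ s.reg 6 ≤ j ∧ j < s.reg 6 + i then s.mem 1 (j - s.reg 6)
        else if a = 4 ∧ s.reg 6 ≤ j ∧ j < s.reg 6 + i then s.mem 2 (j - s.reg 6)
        else s.mem a j) ?_ (fun s' _ h => h) ?_) ?_))
  · refine ⟨by simp, fun r hr => ?_, fun a j => ?_⟩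
    · simp [show r ≠ 2 by omega, show r ≠ 3 by omega, show r ≠ 4 by omega]
    · rw [if_neg (by omega), if_neg (by omega)]
      rfl
  · rintro i s' hi h0 h2 ⟨h4, hr, hm⟩
    refine Runs.cons (Runs.load (Runs.cons (Runs.store (Runs.cons (Runs.load
      (Runs.cons (Runs.store (Runs.succ ⟨?_, ?_, ?_, ?_, ?_⟩))))))))
    · simpa using h0
    · simpa using h2
    · simp [h4]
      omega
    · intro r hr'
      simp [show r ≠ 2 by omega, show r ≠ 3 by omega, show r ≠ 4 by omega, show r ≠ 5 by omega,
        hr r hr']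
    · intro a j
      have e1 : s'.mem 1 i = s.mem 1 i := by simp [hm]
      have e2 : s'.mem 2 i = s.mem 2 i := by simp [hm]
      simp [h4, h2, e1, e2]
      by_cases ha : a = 3
      · subst ha
        by_cases hj : j = s.reg 6 + i
        · subst hj
          simp
        · simp [hj, hm]
          congr 1
          simp
          omega
      · by_cases ha' : a = 4
        · subst ha'
          by_cases hj : j = s.reg 6 + i
          · subst hj
            simp
          · simp [hj, hm]
            congr 1
            simp
            omega
        · simp [ha, ha', hm]
  · rintro s' ⟨h4, hr, hm⟩
    refine Runs.copy ⟨fun r hr' => ?_, by simp [h4], hm⟩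
    simp [show r ≠ 6 by omega, hr r (by omega)]

theorem Runs.pop {n : ℕ} {s : State} (hn : s.reg 0 = n) :
    Runs pop s (n * 8 + 5) fun s' =>
      (∀ r, (r = 0 ∨ 7 ≤ r) → s'.reg r = s.reg r) ∧ s'.reg 6 = s.reg 6 - n ∧
      ∀ a j, s'.mem a j =
        if a = 1 ∧ j < n then s.mem 3 (s.reg 6 - n + j)
        else if a = 2 ∧ j < n then s.mem 4 (s.reg 6 - n + j)
        else s.mem a j := by
  refine Runs.cons (Runs.sub (Runs.cons (Runs.copy
    (Runs.forLoop (n := n) (T := 5) (by decide) (by decide) (by decide) (by simpa using hn)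
    (fun i s' => s'.reg 4 = s.reg 6 - n + i ∧ s'.reg 6 = s.reg 6 - n ∧
      (∀ r, (r = 0 ∨ 7 ≤ r) → s'.reg r = s.reg r) ∧
      ∀ a j, s'.mem a j =
        if a = 1 ∧ j < i then s.mem 3 (s.reg 6 - n + j)
        else if a = 2 ∧ j < i then s.mem 4 (s.reg 6 - n + j)
        else s.mem a j) ?_ (fun s' _ h => ⟨h.2.2.1, h.2.1, h.2.2.2⟩) ?_))))
  · refine ⟨by simp [hn], by simp [hn], fun r hr => ?_, fun a j => ?_⟩
    · simp [show r ≠ 2 by omega, show r ≠ 3 by omega, show r ≠ 4 by omega, show r ≠ 6 by omega]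
    · simp
  · rintro i s' hi h0 h2 ⟨h4, h6, hr, hm⟩
    refine Runs.cons (Runs.load (Runs.cons (Runs.store (Runs.cons (Runs.load
      (Runs.cons (Runs.store (Runs.succ ⟨?_, ?_, ?_, ?_, ?_, ?_⟩))))))))
    · simpa using h0
    · simpa using h2
    · simp [h4]
      omega
    · simpa using h6
    · intro r hr'
      simp [show r ≠ 2 by omega, show r ≠ 3 by omega, show r ≠ 4 by omega, show r ≠ 5 by omega,
        hr r hr']
    · intro a j
      have e1 : ∀ j, s'.mem 3 j = s.mem 3 j := by simp [hm]
      have e2 : ∀ j, s'.mem 4 j = s.mem 4 j := by simp [hm]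
      simp [h4, h2, e1, e2]
      by_cases ha : a = 1
      · subst ha
        by_cases hj : j = i
        · subst hj
          simp
        · simp [hj, hm]
          congr 1
          simp
          omega
      · by_cases ha' : a = 2
        · subst ha'
          by_cases hj : j = i
          · subst hj
            simp
          · simp [hj, hm]
            congr 1
            simp
            omega
        · simp [ha, ha', hm]

/-! ### The branching algorithm -/

/-- Put the vertex in register `x` into the vertex set of array `a`. -/
def mark (a x : ℕ) : Prog := .seq (.const 1 1) (.store a x 1)

/-- Remove the vertex in register `x` from the vertex set of array `a`. -/
def unmark (a x : ℕ) : Prog := .seq (.const 1 0) (.store a x 1)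

/-- If the formula has a witness, then run `p` with the witness in register `10`, else run `q`. -/
def withWitness (φ : Fml 1) (p q : Prog) : Prog := .seq φ.ex.compile (.cond 1 p q)

/-- Continue with the vertex in register `10` in `C`, and leave for later the pair that has this
vertex in `I`. -/
def branch : Prog :=
  .seq (mark 2 (varReg 0)) (.seq push (.seq (unmark 2 (varReg 0)) (mark 1 (varReg 0))))

/-- One round: apply the first rule that fits the current pair. Register `7` is set to zero when the
answer is known, and the answer is put into register `8`. -/
def round : Prog :=
  .seq Fml.conflict.compile (.cond 1
    (.cond 6 pop (.seq (.const 7 0) (.const 8 0)))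
    (withWitness .forcedCluster (mark 1 (varReg 0))
    (withWitness .forcedIndep (mark 2 (varReg 0))
    (withWitness .isolated (mark 2 (varReg 0))
    (withWitness (.ex .branchPair)
      (.seq (Fml.ex .branchPair).compile (.seq branch (mark 2 (varReg 1))))
    (withWitness .branchVertex branch
    (withWitness (.undecided 0) (mark 2 (varReg 0))
    (.seq (.const 7 0) (.const 8 1)))))))))

/-- The program for Monopolar Extension. -/
def solver : Prog :=
  .seq (.const 6 0) (.seq (.const 7 1) (.seq (.loop 7 round) (.copy 0 8)))

section Solver

variable {n : ℕ} {G : SimpleGraph (Fin n)} {C I C₀ I₀ : Set (Fin n)}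
  {L : List (Set (Fin n) × Set (Fin n))} {s : State}

theorem Encodes.congr {m m' : ℕ → ℕ → ℕ} (h : Encodes m G C I)
    (h0 : ∀ j, m' 0 j = m 0 j) (h1 : ∀ v : Fin n, m' 1 v = m 1 v)
    (h2 : ∀ v : Fin n, m' 2 v = m 2 v) : Encodes m' G C I :=
  ⟨fun i j => by rw [h0]; exact h.adj i j, fun v => by rw [h1]; exact h.left v,
    fun v => by rw [h2]; exact h.right v⟩

/-- The state of the machine at the start of a round, with current pair `(C, I)` and stack `L`. -/
structure Active (G : SimpleGraph (Fin n)) (C I : Set (Fin n))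
    (L : List (Set (Fin n) × Set (Fin n))) (s : State) : Prop where
  size : s.reg 0 = n
  running : s.reg 7 ≠ 0
  encodes : Encodes s.mem G C I
  stack : HoldsStack s.mem (s.reg 6) L

theorem Active.preserves {s' : State} {k : ℕ} (h : Active G C I L s) (hs : Preserves k s s') :
    Active G C I L s' := by
  have hr : ∀ r, r = 0 ∨ r = 6 ∨ r = 7 → s'.reg r = s.reg r :=
    fun r hr => hs.2 r (by unfold varReg; omega)
  refine ⟨(hr 0 (by simp)).trans h.size, ?_, hs.1 ▸ h.encodes, ?_⟩
  · rw [hr 7 (by simp)]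
    exact h.running
  · rw [hr 6 (by simp), hs.1]
    exact h.stack

theorem Active.runs_mark_left {x : ℕ} {v : Fin n} (h : Active G C I L s) (hx : 2 ≤ x)
    (hv : s.reg x = v) :
    Runs (mark 1 x) s 2 fun s' => Active G (insert v C) I L s' ∧
      ∀ r, 2 ≤ r → s'.reg r = s.reg r := by
  refine Runs.cons (Runs.const (Runs.store
    ⟨⟨by simp [h.size], by simp [h.running], ⟨fun i j => ?_, fun u => ?_, fun u => ?_⟩, ?_⟩,
      fun r hr => by simp [show r ≠ 1 by omega]⟩))
  · simpa using h.encodes.adj i j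
  · by_cases huv : u = v
    · simp [show x ≠ 1 by omega, hv, huv, bit_of_true]
    · simp [show x ≠ 1 by omega, hv, Fin.val_inj, h.encodes.left, huv]
  · simp [h.encodes.right]
  · simpa using h.stack.congr (by simp)

theorem Active.runs_mark_right {x : ℕ} {v : Fin n} (h : Active G C I L s) (hx : 2 ≤ x)
    (hv : s.reg x = v) :
    Runs (mark 2 x) s 2 fun s' => Active G C (insert v I) L s' ∧
      ∀ r, 2 ≤ r → s'.reg r = s.reg r := by
  refine Runs.cons (Runs.const (Runs.store
    ⟨⟨by simp [h.size], by simp [h.running], ⟨fun i j => ?_, fun u => ?_, fun u => ?_⟩, ?_⟩,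
      fun r hr => by simp [show r ≠ 1 by omega]⟩))
  · simpa using h.encodes.adj i j
  · simp [h.encodes.left]
  · by_cases huv : u = v
    · simp [show x ≠ 1 by omega, hv, huv, bit_of_true]
    · simp [show x ≠ 1 by omega, hv, Fin.val_inj, h.encodes.right, huv]
  · simpa using h.stack.congr (by simp)

theorem Active.runs_unmark_right {x : ℕ} {v : Fin n} (h : Active G C (insert v I) L s)
    (hx : 2 ≤ x) (hv : s.reg x = v) (hvI : v ∉ I) :
    Runs (unmark 2 x) s 2 fun s' => Active G C I L s' ∧
      ∀ r, 2 ≤ r → s'.reg r = s.reg r := by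
  refine Runs.cons (Runs.const (Runs.store
    ⟨⟨by simp [h.size], by simp [h.running], ⟨fun i j => ?_, fun u => ?_, fun u => ?_⟩, ?_⟩,
      fun r hr => by simp [show r ≠ 1 by omega]⟩))
  · simpa using h.encodes.adj i j
  · simp [h.encodes.left]
  · by_cases huv : u = v
    · subst huv
      simp [show x ≠ 1 by omega, hv, bit_of_false hvI]
    · simp [show x ≠ 1 by omega, hv, Fin.val_inj, h.encodes.right, huv]
  · simpa using h.stack.congr (by simp)

theorem Active.runs_push (h : Active G C I L s) :
    Runs push s (n * 8 + 5) fun s' => Active G C I ((C, I) :: L) s' ∧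
      ∀ r, 7 ≤ r → s'.reg r = s.reg r := by
  refine (Runs.push h.size).mono le_rfl ?_
  rintro s' ⟨hr, h6, hm⟩
  refine ⟨⟨(hr 0 (Or.inl rfl)).trans h.size, ?_, ?_, s.reg 6, h6, fun v => ⟨?_, ?_⟩, ?_⟩,
    fun r hr' => hr r (Or.inr hr')⟩
  · rw [hr 7 (Or.inr le_rfl)]
    exact h.running
  · exact h.encodes.congr (by simp [hm]) (by simp [hm]) (by simp [hm])
  · simp [hm, h.encodes.left]
  · simp [hm, h.encodes.right]
  · refine h.stack.congr fun j hj => ?_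
    simp [hm, hj.not_ge]

theorem Active.runs_pop {P : Set (Fin n) × Set (Fin n)} (h : Active G C I (P :: L) s) :
    Runs pop s (n * 8 + 5) (Active G P.1 P.2 L) := by
  refine (Runs.pop h.size).mono le_rfl ?_
  rintro s' ⟨hr, h6, hm⟩
  obtain ⟨sp', h6', hP, hL⟩ := h.stack
  have hsp : s.reg 6 - n = sp' := by omega
  rw [hsp] at h6 hm
  refine ⟨(hr 0 (Or.inl rfl)).trans h.size, ?_, ⟨fun i j => ?_, fun v => ?_, fun v => ?_⟩, ?_⟩
  · rw [hr 7 (Or.inr le_rfl)]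
    exact h.running
  · simpa [hm] using h.encodes.adj i j
  · simp [hm, hP]
  · simp [hm, hP]
  · rw [h6]
    exact hL.congr (by simp [hm])

theorem Active.runs_branch {v : Fin n} (h : Active G C I L s) (hv : s.reg (varReg 0) = v)
    (hvI : v ∉ I) :
    Runs branch s (n * 8 + 11) fun s' => Active G (insert v C) I ((C, insert v I) :: L) s' ∧
      ∀ r, 7 ≤ r → s'.reg r = s.reg r := by
  refine (Runs.seq (h.runs_mark_right (by decide) hv) fun s₁ h₁ => Runs.seq h₁.1.runs_push
    fun s₂ h₂ => ?_).mono (T₁ := 2 + (n * 8 + 5 + (2 + 2))) (by omega) fun _ h => h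
  have e : ∀ r, 7 ≤ r → s₂.reg r = s.reg r := fun r hr =>
    (h₂.2 r hr).trans (h₁.2 r (by omega))
  refine Runs.seq (h₂.1.runs_unmark_right (by decide) ((e _ (by decide)).trans hv) hvI)
    fun s₃ h₃ => ?_
  have e' : ∀ r, 7 ≤ r → s₃.reg r = s.reg r := fun r hr =>
    (h₃.2 r (by omega)).trans (e r hr)
  exact (h₃.1.runs_mark_left (by decide) ((e' _ (by decide)).trans hv)).mono le_rfl
    fun s₄ h₄ => ⟨h₄.1, fun r hr => (h₄.2 r (by omega)).trans (e' r hr)⟩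

theorem Active.runs_withWitness {φ : Fml 1} {p q : Prog} {T₁ T₂ : ℕ} {Q : State → Prop}
    {R : Fin n → Prop} (h : Active G C I L s)
    (hR : ∀ v, φ.Sat G C I (Fin.snoc (α := fun _ => Fin n) Fin.elim0 v) ↔ R v)
    (hp : ∀ v s', R v → Active G C I L s' → s'.reg (varReg 0) = v → Runs p s' T₁ Q)
    (hq : ∀ s', (∀ v, ¬ R v) → Active G C I L s' → Runs q s' T₂ Q) :
    Runs (withWitness φ p q) s (φ.ex.time n + (T₁ + T₂ + 1)) Q := by
  refine (φ.runs_compile_ex Fin.elim0 s h.size h.encodes (fun i => i.elim0)).seq ?_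
  rintro s' ⟨h1, h2, h3⟩
  refine Runs.cond (fun hz => ?_) fun hz => ?_
  · obtain ⟨v, hv, hsat⟩ := h2 hz
    exact (hp v s' ((hR v).1 hsat) (h.preserves h1) hv).mono (by omega) fun _ h => h
  · exact (hq s' (fun v hv => h3 hz v ((hR v).2 hv)) (h.preserves h1)).mono (by omega)
      fun _ h => h

/-- The pairs in `L` extend `(C₀, I₀)`, and one of them is extendable if `(C₀, I₀)` is. -/
def Covers (G : SimpleGraph (Fin n)) (C₀ I₀ : Set (Fin n))
    (L : List (Set (Fin n) × Set (Fin n))) : Prop :=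
  (∀ P ∈ L, C₀ ⊆ P.1 ∧ I₀ ⊆ P.2) ∧
    (Extendable G C₀ I₀ → ∃ P ∈ L, Extendable G P.1 P.2)

/-- The total potential of a list of pairs. -/
noncomputable def totalPotential (G : SimpleGraph (Fin n))
    (L : List (Set (Fin n) × Set (Fin n))) : ℝ :=
  (L.map fun P => potential G P.1 P.2).sum

theorem totalPotential_cons (P : Set (Fin n) × Set (Fin n)) :
    totalPotential G (P :: L) = potential G P.1 P.2 + totalPotential G L := by
  simp [totalPotential]

theorem totalPotential_nonneg (G : SimpleGraph (Fin n)) (L : List (Set (Fin n) × Set (Fin n))) :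
    0 ≤ totalPotential G L := by
  refine List.sum_nonneg fun x hx => ?_
  obtain ⟨P, -, rfl⟩ := List.mem_map.1 hx
  exact zero_le_one.trans (one_le_potential G P.1 P.2)

theorem Covers.cons_of_imp {P Q : Set (Fin n) × Set (Fin n)} (h : Covers G C₀ I₀ (P :: L))
    (hC : P.1 ⊆ Q.1) (hI : P.2 ⊆ Q.2) (hQ : Extendable G P.1 P.2 → Extendable G Q.1 Q.2) :
    Covers G C₀ I₀ (Q :: L) := by
  obtain ⟨h1, h2⟩ := h
  simp only [List.mem_cons, forall_eq_or_imp, exists_eq_or_imp] at h1 h2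
  refine ⟨by simpa using ⟨⟨h1.1.1.trans hC, h1.1.2.trans hI⟩, by simpa using h1.2⟩, fun h => ?_⟩
  simp only [List.mem_cons, exists_eq_or_imp]
  exact (h2 h).imp_left hQ

theorem Covers.cons_cons_of_imp {P Q R : Set (Fin n) × Set (Fin n)}
    (h : Covers G C₀ I₀ (P :: L)) (hC : P.1 ⊆ Q.1) (hI : P.2 ⊆ Q.2) (hC' : P.1 ⊆ R.1)
    (hI' : P.2 ⊆ R.2)
    (hQ : Extendable G P.1 P.2 → Extendable G Q.1 Q.2 ∨ Extendable G R.1 R.2) :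
    Covers G C₀ I₀ (Q :: R :: L) := by
  obtain ⟨h1, h2⟩ := h
  simp only [List.mem_cons, forall_eq_or_imp, exists_eq_or_imp] at h1 h2
  refine ⟨by simpa using ⟨⟨h1.1.1.trans hC, h1.1.2.trans hI⟩,
    ⟨h1.1.1.trans hC', h1.1.2.trans hI'⟩, by simpa using h1.2⟩, fun h => ?_⟩
  simp only [List.mem_cons, exists_eq_or_imp]
  exact (or_assoc).1 ((h2 h).imp_left hQ)

theorem Covers.tail {P : Set (Fin n) × Set (Fin n)} (h : Covers G C₀ I₀ (P :: L))
    (hP : ¬ Extendable G P.1 P.2) : Covers G C₀ I₀ L := by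
  obtain ⟨h1, h2⟩ := h
  simp only [List.mem_cons, forall_eq_or_imp, exists_eq_or_imp] at h1 h2
  exact ⟨h1.2, fun h => (h2 h).resolve_left hP⟩

/-- The state holds the correct answer in register `y`, with a monopolar extension of `(C₀, I₀)`
in the arrays `1` and `2` if there is one. -/
def Answered (G : SimpleGraph (Fin n)) (C₀ I₀ : Set (Fin n)) (y : ℕ) (s : State) : Prop :=
  (s.reg y = 1 ∧ ∃ C I, Displays s C I ∧ IsMonopolarExtension G C₀ I₀ C I) ∨
    (s.reg y = 0 ∧ ¬ Extendable G C₀ I₀)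

/-- The invariant of the main loop, where `k` bounds the number of remaining rounds. -/
def LoopInv (G : SimpleGraph (Fin n)) (C₀ I₀ : Set (Fin n)) (k : ℕ) (s : State) : Prop :=
  (∃ C I L, Active G C I L s ∧ Covers G C₀ I₀ ((C, I) :: L) ∧
      totalPotential G ((C, I) :: L) ≤ k) ∨
    (s.reg 7 = 0 ∧ Answered G C₀ I₀ 8 s)

/-- A bound for the running time of one round: the evaluation of all formulas, and the copying of a
pair to or from the stack. -/
def roundTime (n : ℕ) : ℕ :=
  Fml.conflict.time n + Fml.forcedCluster.ex.time n + Fml.forcedIndep.ex.time n +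
    Fml.isolated.ex.time n + Fml.branchPair.ex.ex.time n + Fml.branchPair.ex.time n +
    Fml.branchVertex.ex.time n + (Fml.undecided 0 : Fml 1).ex.time n + n * 24 + 60

theorem exists_lt_loopInv {k : ℕ} {L' : List (Set (Fin n) × Set (Fin n))} {C' I' : Set (Fin n)}
    (hk : totalPotential G ((C, I) :: L) ≤ k) (hs : Active G C' I' L' s)
    (hc : Covers G C₀ I₀ ((C', I') :: L'))
    (hlt : totalPotential G ((C', I') :: L') + 1 ≤ totalPotential G ((C, I) :: L)) :
    ∃ k' < k, LoopInv G C₀ I₀ k' s := by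
  have h0 := totalPotential_nonneg G ((C', I') :: L')
  obtain ⟨k, rfl⟩ : ∃ m, k = m + 1 := by
    refine ⟨k - 1, (Nat.succ_pred_eq_of_pos ?_).symm⟩
    have : (0 : ℝ) < k := by linarith
    exact_mod_cast this
  refine ⟨k, k.lt_succ_self, Or.inl ⟨C', I', L', hs, hc, ?_⟩⟩
  push_cast at hk
  linarith

theorem exists_lt_loopInv_of_answered {k : ℕ} (hk : totalPotential G ((C, I) :: L) ≤ k)
    (h7 : s.reg 7 = 0) (h8 : Answered G C₀ I₀ 8 s) : ∃ k' < k, LoopInv G C₀ I₀ k' s := by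
  refine ⟨0, ?_, Or.inr ⟨h7, h8⟩⟩
  have h1 := one_le_potential G C I
  have h2 := totalPotential_nonneg G L
  rw [totalPotential_cons] at hk
  have : (0 : ℝ) < k := by linarith
  exact_mod_cast this

/-- One round keeps the invariant, and either ends the search or decreases the total potential by at
least one. -/
theorem Active.runs_round {k : ℕ} (h : Active G C I L s) (hc : Covers G C₀ I₀ ((C, I) :: L))
    (hk : totalPotential G ((C, I) :: L) ≤ k) :
    Runs round s (roundTime n) fun s' => ∃ k' < k, LoopInv G C₀ I₀ k' s' := by
  have stepC : ∀ v s', Undecided C I v → (Extendable G C I → Extendable G (insert v C) I) →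
      Active G C I L s' → s'.reg (varReg 0) = v →
      Runs (mark 1 (varReg 0)) s' 2 fun s' => ∃ k' < k, LoopInv G C₀ I₀ k' s' := by
    intro v s' hU hE hs' hv
    refine (hs'.runs_mark_left (by decide) hv).mono le_rfl fun s'' hs'' =>
      exists_lt_loopInv hk hs''.1 (hc.cons_of_imp (Set.subset_insert v C) (subset_refl I) hE) ?_
    have := potential_add_one_le (G := G) (Set.subset_insert v C) (subset_refl I) hU
      fun h => h.1 (Set.mem_insert v C)
    simp only [totalPotential_cons]
    linarith
  have stepI : ∀ v s', Undecided C I v → (Extendable G C I → Extendable G C (insert v I)) →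
      Active G C I L s' → s'.reg (varReg 0) = v →
      Runs (mark 2 (varReg 0)) s' 2 fun s' => ∃ k' < k, LoopInv G C₀ I₀ k' s' := by
    intro v s' hU hE hs' hv
    refine (hs'.runs_mark_right (by decide) hv).mono le_rfl fun s'' hs'' =>
      exists_lt_loopInv hk hs''.1 (hc.cons_of_imp (subset_refl C) (Set.subset_insert v I) hE) ?_
    have := potential_add_one_le (G := G) (subset_refl C) (Set.subset_insert v I) hU
      fun h => h.2 (Set.mem_insert v I)
    simp only [totalPotential_cons]
    linarith
  refine ((Fml.conflict.runs_compile Fin.elim0 s h.size h.encodes (fun i => i.elim0)).seq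
    (T₂ := roundTime n - Fml.conflict.time n - 1 + 1) ?_).mono (by unfold roundTime; omega)
    fun _ h => h
  rintro s' ⟨h1, h2⟩
  rw [Fml.sat_conflict] at h1
  replace h := h.preserves h2
  refine Runs.cond (fun hz => ?_) fun hz => ?_
  · have hconf := h1.1 hz
    have hc' := hc.tail hconf.not_extendable
    refine (Runs.cond (T := n * 8 + 5) (fun hz' => ?_) fun hz' => ?_).mono
      (by unfold roundTime; omega) fun _ h => h
    · obtain _ | ⟨P, L⟩ := L
      · exact absurd h.stack hz'
      · refine h.runs_pop.mono le_rfl fun s'' hs'' => exists_lt_loopInv hk hs'' hc' ?_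
        have := one_le_potential G C I
        simp only [totalPotential_cons]
        linarith
    · obtain _ | ⟨P, L⟩ := L
      · refine (Runs.cons (Runs.const (Runs.const ?_))).mono (T₁ := 2) (by omega) fun _ h => h
        refine exists_lt_loopInv_of_answered hk (by simp) (Or.inr ⟨by simp, fun hE => ?_⟩)
        obtain ⟨P, hP, -⟩ := hc'.2 hE
        exact absurd hP List.not_mem_nil
      · -- A conflict involves a vertex, so a nonempty stack occupies at least one cell.
        have hn : 0 < n := by
          obtain ⟨v, -⟩ | ⟨v, -⟩ | ⟨v, -⟩ := hconf <;> exact v.pos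
        obtain ⟨sp', hsp, -⟩ := h.stack
        omega
  · have hnc : ¬ Conflict G C I := fun hcf => h1.2 hcf hz
    have hq : ∀ {p T Q} {s : State}, Runs p s T Q → ∀ {T'}, T ≤ T' → Runs p s T' Q :=
      fun h _ hT => h.mono hT fun _ h => h
    refine hq (h.runs_withWitness (fun v => Fml.sat_forcedCluster)
      (fun v s' hv hs' => stepC v s' hv.1 hv.extendable hs') fun s' hFC h =>
      h.runs_withWitness (fun v => Fml.sat_forcedIndep)
      (fun v s' hv hs' => stepI v s' hv.1 hv.extendable hs') fun s' hFI h =>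
      h.runs_withWitness (fun v => Fml.sat_isolated)
      (fun v s' hv hs' => stepI v s' hv.1 (hv.extendable hFC) hs') fun s' hZ h =>
      h.runs_withWitness (R := fun a => ∃ c, BranchPair G C I a c) (fun v => Iff.rfl)
      (T₁ := Fml.branchPair.ex.time n + (n * 8 + 11 + 2)) ?_ fun s' hP h =>
      h.runs_withWitness (fun v => Fml.sat_branchVertex) (T₁ := n * 8 + 11) ?_ fun s' hB h =>
      h.runs_withWitness (fun v => Fml.sat_undecided)
      (fun v s' hv hs' => stepI v s' hv (fun _ => extendable_insert_of_exhausted hnc hFC hFI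
        (fun a c hac => hP a ⟨c, hac⟩) hB hv) hs') (T₂ := 2) fun s' hU h => ?_) ?_
    · rintro a s' ha h hreg
      refine (Fml.branchPair.runs_compile_ex (fun _ => a) s' h.size h.encodes
        (fun i => by rw [Fin.fin_one_eq_zero i]; exact hreg)).seq ?_
      rintro s₁ ⟨h1, h2, h3⟩
      have hz : s₁.reg 1 ≠ 0 := fun hz => ha.elim fun c hac => h3 hz c hac
      obtain ⟨c, hcreg, hac⟩ := h2 hz
      rw [Fml.sat_branchPair] at hac
      have hreg' := (h1.2 (varReg 0) (by decide)).trans hreg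
      refine ((h.preserves h1).runs_branch hreg' hac.1.1.2).seq fun s₂ h₂ => ?_
      refine (h₂.1.runs_mark_right (by decide) ((h₂.2 _ (by decide)).trans hcreg)).mono le_rfl
        fun s₃ h₃ => exists_lt_loopInv hk h₃.1 (hc.cons_cons_of_imp (Set.subset_insert a C)
          (Set.subset_insert c I) (subset_refl C) (Set.subset_insert a I) hac.1.extendable) ?_
      have := potential_branchPair hFC hFI hZ hac
      simp only [totalPotential_cons]
      linarith
    · rintro b s' hb h hreg
      refine (h.runs_branch hreg hb.1.2).mono le_rfl fun s₂ h₂ =>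
        exists_lt_loopInv hk h₂.1 (hc.cons_cons_of_imp (Set.subset_insert b C)
          (subset_refl I) (subset_refl C) (Set.subset_insert b I)
          fun hE => hE.insert_or_insert b) ?_
      have := potential_branchVertex hFC hFI (fun a c hac => hP a ⟨c, hac⟩) hb
      simp only [totalPotential_cons]
      linarith
    · have hCI := hc.1 (C, I) List.mem_cons_self
      refine Runs.cons (Runs.const (Runs.const (exists_lt_loopInv_of_answered hk (by simp)
        (Or.inl ⟨by simp, C, I, fun v => ⟨?_, ?_⟩,
          isMonopolarExtension_of_decided hnc hU hCI.1 hCI.2⟩))))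
      · simpa using h.encodes.left v
      · simpa using h.encodes.right v
    · unfold roundTime
      omega

/-- The running time of the solver. -/
noncomputable def solverTime (n : ℕ) : ℕ :=
  ⌈((5 * n + 5 : ℕ) : ℝ) * base ^ n⌉₊ * (roundTime n + 1) + 4

theorem runs_solver (hn : s.reg 0 = n) (hs : Encodes s.mem G C₀ I₀) :
    Runs solver s (solverTime n) (Answered G C₀ I₀ 0) := by
  refine Runs.cons (Runs.const (Runs.cons (Runs.const ?_)))
  refine Runs.seq (T₂ := 1) (R := Answered G C₀ I₀ 8) (Runs.loop (LoopInv G C₀ I₀) ?_ ?_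
    ⌈((5 * n + 5 : ℕ) : ℝ) * base ^ n⌉₊ ?_) ?_
  · rintro k s (⟨C, I, L, h, -⟩ | ⟨-, h⟩) hz
    · exact absurd hz h.running
    · exact h
  · rintro k s (⟨C, I, L, h, hc, hk⟩ | ⟨h, -⟩) hz
    · exact h.runs_round hc hk
    · exact absurd h hz
  · refine Or.inl ⟨C₀, I₀, [], ⟨by simpa using hn, by simp, hs, by simp [HoldsStack]⟩,
      ⟨by simp, fun h => ⟨_, List.mem_singleton_self _, h⟩⟩, ?_⟩
    refine le_trans ?_ (Nat.le_ceil _)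
    simpa [totalPotential] using potential_le G C₀ I₀
  · rintro s' (⟨h1, C, I, hd, hE⟩ | ⟨h1, hE⟩)
    · exact Runs.copy (Or.inl ⟨by simpa using h1, C, I, hd, hE⟩)
    · exact Runs.copy (Or.inr ⟨by simpa using h1, hE⟩)

end Solver

theorem exists_polynomial_roundTime : ∃ q : Polynomial ℕ, ∀ n, roundTime n = q.eval n := by
  obtain ⟨q₁, h₁⟩ := Fml.conflict.exists_polynomial
  obtain ⟨q₂, h₂⟩ := Fml.forcedCluster.ex.exists_polynomial
  obtain ⟨q₃, h₃⟩ := Fml.forcedIndep.ex.exists_polynomial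
  obtain ⟨q₄, h₄⟩ := Fml.isolated.ex.exists_polynomial
  obtain ⟨q₅, h₅⟩ := Fml.branchPair.ex.ex.exists_polynomial
  obtain ⟨q₆, h₆⟩ := Fml.branchPair.ex.exists_polynomial
  obtain ⟨q₇, h₇⟩ := Fml.branchVertex.ex.exists_polynomial
  obtain ⟨q₈, h₈⟩ := (Fml.undecided 0 : Fml 1).ex.exists_polynomial
  refine ⟨q₁ + q₂ + q₃ + q₄ + q₅ + q₆ + q₇ + q₈ + .X * 24 + 60, fun n => ?_⟩
  simp [roundTime, h₁, h₂, h₃, h₄, h₅, h₆, h₇, h₈]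

/-- Polynomially many steps in each round, and a linear number of steps besides. -/
theorem isOStar_solverTime (c : ℕ) :
    IsOStar (fun n => solverTime n + (n * c + c)) fun n => (1.3734 : ℝ) ^ n := by
  obtain ⟨q, hq⟩ := exists_polynomial_roundTime
  refine ⟨(5 * .X + 6) * (q + 1) + 4 + (.X * .C c + .C c), fun n => ?_⟩
  have h1 : (1 : ℝ) ≤ 1.3734 ^ n := one_le_base_pow n
  have h2 : (⌈((5 * n + 5 : ℕ) : ℝ) * base ^ n⌉₊ : ℝ) ≤ (5 * n + 6) * 1.3734 ^ n := by
    have := (Nat.ceil_lt_add_one (a := ((5 * n + 5 : ℕ) : ℝ) * base ^ n) (by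
      unfold base; positivity)).le
    unfold base at *
    push_cast at *
    linarith
  have h3 : (0 : ℝ) ≤ (n * c + c : ℕ) := by positivity
  have h4 : (⌈((5 * n + 5 : ℕ) : ℝ) * base ^ n⌉₊ : ℝ) * (roundTime n + 1) ≤
      (5 * n + 6) * 1.3734 ^ n * (roundTime n + 1) := by gcongr
  have h5 : ((4 + (n * c + c) : ℕ) : ℝ) * 1 ≤ ((4 + (n * c + c) : ℕ) : ℝ) * 1.3734 ^ n := by gcongr
  have h6 : (((5 * .X + 6) * (q + 1) + 4 + (.X * .C c + .C c) : Polynomial ℕ).eval n : ℕ) =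
      (5 * n + 6) * (roundTime n + 1) + 4 + (n * c + c) := by
    simp [hq]
  rw [h6]
  unfold solverTime
  push_cast at *
  linarith

/-! ### List Monopolar Partition -/

/-- Replace the set of vertices that may go to the cluster part by those that have to, and likewise
for the independent part: each set becomes the complement of the other. -/
def listToSets : Prog :=
  forLoop 2 3 (.seq (.load 4 1 2) (.seq (.load 5 2 2) (.seq (.const 6 1) (.seq (.sub 4 6 4)
    (.seq (.sub 5 6 5) (.seq (.store 1 2 5) (.store 2 2 4)))))))

theorem runs_listToSets {n : ℕ} {G : SimpleGraph (Fin n)} {A B : Set (Fin n)} {s : State}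
    (hn : s.reg 0 = n) (hs : Encodes s.mem G A B) :
    Runs listToSets s (n * 10 + 3) fun s' => s'.reg 0 = n ∧ Encodes s'.mem G Bᶜ Aᶜ := by
  refine Runs.forLoop (T := 7) (by decide) (by decide) (by decide) hn
    (fun i s' => ∀ a j, s'.mem a j =
      if a = 1 ∧ j < i then 1 - s.mem 2 j else if a = 2 ∧ j < i then 1 - s.mem 1 j
      else s.mem a j) ?_ ?_ ?_
  · simp
  · intro s' h0 hm
    refine ⟨h0, fun i j => ?_, fun v => ?_, fun v => ?_⟩
    · simpa [hm] using hs.adj i j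
    · by_cases hv : v ∈ B <;> simp [hm, hs.right, bit_of_true, bit_of_false, hv]
    · by_cases hv : v ∈ A <;> simp [hm, hs.left, bit_of_true, bit_of_false, hv]
  · rintro i s' hi h0 h2 hm
    refine Runs.cons (Runs.load (Runs.cons (Runs.load (Runs.cons (Runs.const (Runs.cons
      (Runs.sub (Runs.cons (Runs.sub (Runs.cons (Runs.store (Runs.store ⟨?_, ?_, ?_⟩))))))))))))
    · simpa using h0
    · simpa using h2
    · intro a j
      have e1 : s'.mem 1 i = s.mem 1 i := by simp [hm]
      have e2 : s'.mem 2 i = s.mem 2 i := by simp [hm]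
      simp [h2, e1, e2]
      by_cases ha : a = 1
      · subst ha
        by_cases hj : j = i
        · subst hj
          simp
        · simp [hj, hm]
          congr 1
          simp
          omega
      · by_cases ha' : a = 2
        · subst ha'
          by_cases hj : j = i
          · subst hj
            simp
          · simp [hj, hm]
            congr 1
            simp
            omega
        · simp [ha, ha', hm]

theorem encodes_inputState {n : ℕ} (G : SimpleGraph (Fin n)) (A B : Set (Fin n)) :
    Encodes (inputState G A B).mem G A B := by
  refine ⟨fun i j => ?_, fun v => ?_, fun v => ?_⟩
  · simp only [inputState, if_true, bit_ne_zero]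
    refine ⟨?_, fun h => ⟨i, j, rfl, h⟩⟩
    rintro ⟨i', j', h, hadj⟩
    have hi : (i : ℕ) = i' := by
      have := congrArg (· / n) h
      simpa [Nat.mul_comm _ n, Nat.mul_add_div i.pos, Nat.div_eq_of_lt] using this
    have hj : (j : ℕ) = j' := by
      rw [hi] at h
      exact Nat.add_left_cancel h
    rwa [Fin.ext hi, Fin.ext hj]
  · simp [inputState, Fin.val_inj]
  · simp [inputState, Fin.val_inj]

/-- A partition respects the lists if and only if it extends the pair of sets of vertices whose
lists do not contain the other label. -/
theorem respectsList_iff {V : Type*} {G : SimpleGraph V} {L : V → Set Part} {f : V → Part} :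
    RespectsList G L f ↔ IsMonopolarExtension G {v | Part.indep ∈ L v}ᶜ {v | Part.cluster ∈ L v}ᶜ
      (f ⁻¹' {Part.cluster}) (f ⁻¹' {Part.indep}) := by
  have hcompl : f ⁻¹' {Part.cluster} ∪ f ⁻¹' {Part.indep} = Set.univ := by
    ext v
    cases h : f v <;> simp [h]
  have hdisj : Disjoint (f ⁻¹' {Part.cluster}) (f ⁻¹' {Part.indep}) :=
    Disjoint.preimage f (by simp)
  have hL : (∀ v, f v ∈ L v) ↔ {v | Part.indep ∈ L v}ᶜ ⊆ f ⁻¹' {Part.cluster} ∧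
      {v | Part.cluster ∈ L v}ᶜ ⊆ f ⁻¹' {Part.indep} := by
    simp only [Set.subset_def, ← forall_and]
    refine forall_congr' fun v => ?_
    cases h : f v <;> simp [h]
  unfold RespectsList IsMonopolarExtension IsMonopolarPartition
  rw [hL]
  tauto

open Classical in
theorem exists_respectsList {V : Type*} {G : SimpleGraph V} {L : V → Set Part} {C I : Set V}
    (h : IsMonopolarExtension G {v | Part.indep ∈ L v}ᶜ {v | Part.cluster ∈ L v}ᶜ C I) :
    ∃ f : V → Part, RespectsList G L f ∧ f ⁻¹' {Part.cluster} = C ∧ f ⁻¹' {Part.indep} = I := by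
  have hI : I = Cᶜ := ((isMonopolarPartition_iff G C I).1 h.1).1
  have h1 : (fun v => if v ∈ C then Part.cluster else Part.indep) ⁻¹' {Part.cluster} = C := by
    ext v
    by_cases hv : v ∈ C <;> simp [hv]
  have h2 : (fun v => if v ∈ C then Part.cluster else Part.indep) ⁻¹' {Part.indep} = I := by
    ext v
    by_cases hv : v ∈ C <;> simp [hv, hI]
  exact ⟨_, respectsList_iff.2 (by rwa [h1, h2]), h1, h2⟩

end MonopolarAlg

theorem theorem2 :
    (∃ (p : MonopolarAlg.Prog) (T : ℕ → ℕ),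
      MonopolarAlg.IsOStar T (fun n => (1.3734 : ℝ) ^ n) ∧
        MonopolarAlg.SolvesMonopolarExtension p T) ∧
    (∃ (p : MonopolarAlg.Prog) (T : ℕ → ℕ),
      MonopolarAlg.IsOStar T (fun n => (1.3734 : ℝ) ^ n) ∧
        MonopolarAlg.SolvesListMonopolarPartition p T) := by
  open MonopolarAlg in
  refine ⟨⟨solver, _, isOStar_solverTime 0, fun n G C₀ I₀ => ?_⟩,
    ⟨.seq listToSets solver, _, isOStar_solverTime 10, fun n G L _ => ?_⟩⟩
  · obtain ⟨t, s, he, ht, h⟩ := runs_solver (n := n) (s := inputState G C₀ I₀) rfl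
      (encodes_inputState G C₀ I₀)
    refine ⟨t, s, he, by simpa using ht, ?_⟩
    rw [exists_isMonopolarExtension_iff]
    obtain ⟨h0, C, I, hd, hE⟩ | ⟨h0, hE⟩ := h
    · exact ⟨fun _ => ⟨h0, C, I, hE, hd⟩,
        fun hn => absurd ((exists_isMonopolarExtension_iff G C₀ I₀).1 ⟨C, I, hE⟩) hn⟩
    · exact ⟨fun h => absurd h hE, fun _ => h0⟩
  · obtain ⟨t, s, he, ht, h⟩ :=
      (runs_listToSets (n := n)
        (s := inputState G {v | Part.cluster ∈ L v} {v | Part.indep ∈ L v}) rfl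
        (encodes_inputState G _ _)).seq fun s' hs' => runs_solver hs'.1 hs'.2
    refine ⟨t, s, he, ht.trans (by omega), ?_⟩
    obtain ⟨h0, C, I, hd, hE⟩ | ⟨h0, hE⟩ := h
    · obtain ⟨f, hf, rfl, rfl⟩ := exists_respectsList hE
      exact ⟨fun _ => ⟨h0, f, hf, hd⟩, fun hn => absurd ⟨f, hf⟩ hn⟩
    · refine ⟨fun ⟨f, hf⟩ => absurd ?_ hE, fun _ => h0⟩
      exact (exists_isMonopolarExtension_iff G _ _).1 ⟨_, _, respectsList_iff.1 hf⟩
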